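/- Let $k\ge 2$. Consider the database schema with distinct relation names $R_1,\dots,R_k,S_k$, where each $R_i$ is binary and its first position is its primary key, and $S_k$ has arity $k$ and is all-key (its primary key consists of all $k$ positions). An uncertain database is a finite set $\mathbf{db}$ of facts over this schema; two facts are key-equal if they have the same relation name and the same primary key value. A repair of $\mathbf{db}$ is a maximal subset of $\mathbf{db}$ that does not contain two distinct key-equal facts. Let $\mathrm{ACq}_k$ be the Boolean conjunctive query $$\exists x_1\cdots\exists x_k\bigl(R_1(\underline{x_1},x_2)\wedge R_2(\underline{x_2},x_3)\wedge\dots\wedge R_{k-1}(\underline{x_{k-1}},x_k)\wedge R_k(\underline{x_k},x_1)\wedge S_k(\underline{x_1,\dots,x_k})\bigr),$$ where $x_1,\dots,x_k$ are distinct variables. Let $\mathrm{CERTAINTY}(\mathrm{ACq}_k)$ be the problem whose input is an uncertain database $\mathbf{db}$ and which asks whether every repair of $\mathbf{db}$ satisfies $\mathrm{ACq}_k$. Then, for every fixed $k\ge 2$, $\mathrm{CERTAINTY}(\mathrm{ACq}_k)$ is in $\mathbf{P}$. -/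

import Mathlib

namespace CQA

/-! ### Atoms, facts, and uncertain databases -/

/-- A database schema: a finite set of relation names, each with a fixed signature `(n, m)`,
`n ≥ m ≥ 1`, where `n` is the arity and the first `m` positions form the primary key. -/
structure Schema where
  Rel : Type
  finite_rel : Finite Rel
  arity : Rel → ℕ
  keyLen : Rel → ℕ
  one_le_keyLen : ∀ r, 1 ≤ keyLen r
  keyLen_le_arity : ∀ r, keyLen r ≤ arity r

/-- An atom `R(s₁, …, sₙ)` over the schema `σ` whose arguments are taken from `T`. -/
structure Atom (σ : Schema) (T : Type) where
  rel : σ.Rel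
  args : List T
  length_args : args.length = σ.arity rel

/-- The (countably infinite) set of constants: the words over `{0, 1}`. -/
abbrev Const : Type := List Bool

/-- A fact is an atom in which no variable occurs. -/
abbrev Fact (σ : Schema) : Type := Atom σ Const

/-- The primary key value of a fact: the sequence of its first `keyLen` arguments. -/
def Fact.key {σ : Schema} (A : Fact σ) : List Const :=
  A.args.take (σ.keyLen A.rel)

/-- Two facts are key-equal if they have the same relation name and the same key value. -/
def KeyEqual {σ : Schema} (A B : Fact σ) : Prop :=
  A.rel = B.rel ∧ Fact.key A = Fact.key B

/-- An uncertain database is a finite set of facts. -/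
abbrev Database (σ : Schema) : Type := Finset (Fact σ)

/-- A database is consistent if it does not contain two distinct key-equal facts. -/
def Consistent {σ : Schema} (db : Database σ) : Prop :=
  ∀ A ∈ db, ∀ B ∈ db, KeyEqual A B → A = B

/-- A repair of `db` is a maximal (for inclusion) consistent subset of `db`. -/
def IsRepair {σ : Schema} (db rep : Database σ) : Prop :=
  Maximal (fun s : Database σ => s ⊆ db ∧ Consistent s) rep

/-! ### Boolean conjunctive queries and certain answers -/

/-- A Boolean conjunctive query with variables in `V`: a finite set of atoms, each of whose
arguments is a variable or a constant. -/
abbrev Query (σ : Schema) (V : Type) : Type := Finset (Atom σ (V ⊕ Const))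

/-- Application of a valuation `θ` to an atom; `θ` is the identity on constants. -/
def Atom.subst {σ : Schema} {V : Type} (θ : V → Const) (F : Atom σ (V ⊕ Const)) : Fact σ where
  rel := F.rel
  args := F.args.map (Sum.elim θ id)
  length_args := by rw [List.length_map, F.length_args]

/-- `db ⊨ q`: some valuation maps every atom of `q` to a fact of `db`. -/
def Satisfies {σ : Schema} {V : Type} (db : Database σ) (q : Query σ V) : Prop :=
  ∃ θ : V → Const, ∀ F ∈ q, F.subst θ ∈ db

/-- `CERTAINTY(q)`: the set of the uncertain databases all of whose repairs satisfy `q`. -/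
def certainty {σ : Schema} {V : Type} (q : Query σ V) : Set (Database σ) :=
  {db | ∀ rep, IsRepair db rep → Satisfies rep q}

/-! ### Databases as input words -/

/-- The input alphabet: one symbol per relation name, two bits, and a symbol that ends a
constant. -/
inductive Symbol (σ : Schema) : Type where
  | rel (r : σ.Rel)
  | bit (b : Bool)
  | sep

/-- A constant is written as its bits followed by `sep`. -/
def encodeConst {σ : Schema} (c : Const) : List (Symbol σ) :=
  c.map Symbol.bit ++ [Symbol.sep]

/-- A fact is written as its relation name followed by its arguments. -/
def encodeFact {σ : Schema} (A : Fact σ) : List (Symbol σ) :=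
  Symbol.rel A.rel :: A.args.flatMap encodeConst

/-- A list of facts is written fact by fact. -/
def encodeFacts {σ : Schema} (l : List (Fact σ)) : List (Symbol σ) :=
  l.flatMap encodeFact

theorem encodeConst_append_inj {σ : Schema} (c d : Const) (u v : List (Symbol σ))
    (h : encodeConst c ++ u = encodeConst d ++ v) : c = d ∧ u = v := by
  induction c generalizing d with
  | nil => cases d <;> simp_all [encodeConst]
  | cons b c ih =>
    cases d with
    | nil => simp [encodeConst] at h
    | cons b' d =>
      have h' : b = b' ∧ encodeConst c ++ u = encodeConst d ++ v := by
        simpa [encodeConst] using h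
      have := ih d h'.2
      simp [h'.1, this.1, this.2]

theorem encodeArgs_append_inj {σ : Schema} (a b : List Const) (u v : List (Symbol σ))
    (hl : a.length = b.length)
    (h : a.flatMap encodeConst ++ u = b.flatMap encodeConst ++ v) : a = b ∧ u = v := by
  induction a generalizing b with
  | nil =>
    cases b with
    | nil => simpa using h
    | cons d b => simp at hl
  | cons c a ih =>
    cases b with
    | nil => simp at hl
    | cons d b =>
      simp only [List.flatMap_cons, List.append_assoc] at h
      obtain ⟨rfl, h'⟩ := encodeConst_append_inj _ _ _ _ h
      obtain ⟨rfl, rfl⟩ := ih b (by simpa using hl) h'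
      exact ⟨rfl, rfl⟩

/-- The encoding is uniquely decodable. -/
theorem encodeFacts_injective (σ : Schema) :
    Function.Injective (encodeFacts : List (Fact σ) → List (Symbol σ)) := by
  intro l
  induction l with
  | nil =>
    intro m h
    cases m with
    | nil => rfl
    | cons B m => simp [encodeFacts, encodeFact] at h
  | cons A l ih =>
    intro m h
    cases m with
    | nil => simp [encodeFacts, encodeFact] at h
    | cons B m =>
      obtain ⟨r, a, ha⟩ := A
      obtain ⟨s, b, hb⟩ := B
      have h' : r = s ∧ a.flatMap encodeConst ++ encodeFacts l
          = b.flatMap encodeConst ++ encodeFacts m := by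
        simpa [encodeFacts, encodeFact] using h
      obtain ⟨rfl, h'⟩ := h'
      obtain ⟨rfl, h2⟩ := encodeArgs_append_inj _ _ _ _ (ha.trans hb.symm) h'
      rw [ih h2]

/-- The language of a decision problem `P` on uncertain databases: the words that list, in any
order and possibly with repetitions, the facts of a database that belongs to `P`. Words that do
not encode a list of facts are not in the language. -/
def languageOf {σ : Schema} (P : Set (Database σ)) : Language (Symbol σ) :=
  {w | ∃ db ∈ P, ∃ l : List (Fact σ), (∀ A, A ∈ l ↔ A ∈ db) ∧ w = encodeFacts l}

/-! ### The class P -/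

open Classical in
/-- A language is in P if its characteristic function is computed by a (multi-stack) Turing
machine within a number of steps that is polynomial in the length of the input word. -/
def InP {Γ : Type} (L : Language Γ) : Prop :=
  Nonempty (Turing.TM2ComputableInPolyTime (id : List Γ → List Γ) Computability.encodeBool
    (fun w => decide (w ∈ L)))

/-! ### The query `ACq_k` -/

/-- The relation names `R₁, …, R_k, S_k`; the indices are `0, …, k - 1` here. -/
inductive ACqRel (k : ℕ) : Type where
  | R (i : Fin k)
  | S

theorem ACqRel.finite (k : ℕ) : Finite (ACqRel k) :=
  Finite.of_surjective (fun o : Option (Fin k) => o.elim ACqRel.S ACqRel.R) fun r =>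
    match r with
    | .R i => ⟨some i, rfl⟩
    | .S => ⟨none, rfl⟩

/-- `R_i` has signature `(2, 1)` and `S_k` has signature `(k, k)`. -/
def acqSchema (k : ℕ) (hk : 2 ≤ k) : Schema where
  Rel := ACqRel k
  finite_rel := ACqRel.finite k
  arity
    | .R _ => 2
    | .S => k
  keyLen
    | .R _ => 1
    | .S => k
  one_le_keyLen := by rintro (_ | _) <;> simp; omega
  keyLen_le_arity := by rintro (_ | _) <;> simp

/-- The cyclic successor of an index. -/
def cyclicSucc {k : ℕ} (i : Fin k) : Fin k :=
  ⟨(i + 1) % k, Nat.mod_lt _ i.pos⟩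

/-- The atom `R_i(x_i, x_{i+1})`, with `x_{k+1} = x_1`. -/
def acqR (k : ℕ) (hk : 2 ≤ k) (i : Fin k) : Atom (acqSchema k hk) (Fin k ⊕ Const) where
  rel := ACqRel.R i
  args := [Sum.inl i, Sum.inl (cyclicSucc i)]
  length_args := rfl

/-- The atom `S_k(x_1, …, x_k)`. -/
def acqS (k : ℕ) (hk : 2 ≤ k) : Atom (acqSchema k hk) (Fin k ⊕ Const) where
  rel := ACqRel.S
  args := List.ofFn Sum.inl
  length_args := by rw [List.length_ofFn]; rfl

open Classical in
/-- The query `ACq_k = {R₁(x₁, x₂), R₂(x₂, x₃), …, R_k(x_k, x₁), S_k(x₁, …, x_k)}`. -/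
noncomputable def acq (k : ℕ) (hk : 2 ≤ k) : Query (acqSchema k hk) (Fin k) :=
  insert (acqS k hk) (Finset.univ.image (acqR k hk))

end CQA

/-! Combinatorics. Read a fact `R_i(a, b)` as an edge from `(i, a)` to `(i + 1, b)`, positions taken
modulo `k`. A repair keeps exactly one edge at every vertex with outgoing edges and, `S_k` being
all-key, every `S_k`-fact. It falsifies the query iff the kept edges contain none of the `k`-cycles
listed by `S_k`. So non-certainty is the existence of a choice of outgoing edges that avoids a given
set `C` of `k`-cycles (`not_mem_certainty_iff`).

Such a choice exists iff every vertex reaches a sink or an elementary cycle outside `C`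
(`exists_region_univ_iff`). Necessity: if no sink is reachable, following the choice ends in a
chosen cycle, which is not in `C`. Sufficiency: fix the choice on a sink or on a good cycle and let
it spread backwards along edges, which closes no further cycle. Choices on closed sets can be glued,
since a cycle that meets a closed set stays in it (`Region.extend`).

All cycle lengths are multiples of `k`, so a cycle outside `C` is either a `k`-cycle not listed or a
longer cycle. Both kinds are found by listing the walks with `k` edges, polynomially many for fixed
`k`, and testing whether the end can return to the start while avoiding the inner vertices
(`OnGoodCycle`, `decideCertainty`).

Complexity. Data are binary trees in prefix code on stacks. Structured stack programs compile step
by step to `TM2` (`Exec.steps`), and the functions they compute in polynomial time are closed under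
composition, pairing, case distinction and folds with bounded intermediate results (`PF.loop`,
`PT.foldl`). The parser and the decision procedure are list programs of this kind, and `inP_of_PT`
turns them into a machine. -/

namespace TreeMachine

/-! ### A structured stack language and its compilation to Turing machines. -/

open Turing

/-! ### Structured programs on four stacks -/

/-- The symbols on the work stacks: the two symbols of the prefix code of trees, and a marker. -/
inductive Tok : Type where
  | leaf
  | node
  | mark
  deriving DecidableEq

/-- The work stacks. -/
inductive Reg : Type where
  | A
  | B
  | C
  | D
  deriving DecidableEq

instance : Fintype Tok := ⟨{.leaf, .node, .mark}, by rintro (_ | _ | _) <;> simp⟩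

instance : Fintype Reg := ⟨{.A, .B, .C, .D}, by rintro (_ | _ | _ | _) <;> simp⟩

/-- Structured programs. -/
inductive Prog : Type where
  | push (r : Reg) (a : Tok)
  | pop (r : Reg)
  | seq (p q : Prog)
  | case (r : Reg) (f : Option Tok → Prog)
  | loop (r : Reg) (b : Option Tok → Bool) (p : Prog)

/-- Contents of the work stacks. -/
abbrev Store : Type := Reg → List Tok

/-- `Exec p s t s'`: started on `s`, the program `p` ends on `s'` after `t` steps. -/
inductive Exec : Prog → Store → ℕ → Store → Prop where
  | push (r a s) : Exec (.push r a) s 1 (Function.update s r (a :: s r))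
  | pop (r s) : Exec (.pop r) s 1 (Function.update s r (s r).tail)
  | seq {p q s t s' t' s''} : Exec p s t s' → Exec q s' t' s'' → Exec (.seq p q) s (t + t') s''
  | case {r f s t s'} : Exec (f (s r).head?) s t s' → Exec (.case r f) s (1 + t) s'
  | loop_done {r b p s} : b (s r).head? = false → Exec (.loop r b p) s 1 s
  | loop_step {r b p s t s' t' s''} : b (s r).head? = true → Exec p s t s' →
      Exec (.loop r b p) s' t' s'' → Exec (.loop r b p) s (1 + t + t') s''

/-! ### Compilation to `TM2` -/

/-- The labels of a compiled program. -/
def Lab : Prog → Type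
  | .push _ _ => Unit
  | .pop _ => Unit
  | .seq p q => Lab p ⊕ Lab q
  | .case _ f => Option (Σ o, Lab (f o))
  | .loop _ _ p => Option (Lab p)

/-- The label set of a machine must be finite; the branches of a `case` are indexed by the finite
type `Option Tok`. -/
theorem Lab.finite (p : Prog) : Finite (Lab p) := by
  induction p with
  | push r a => exact inferInstanceAs (Finite Unit)
  | pop r => exact inferInstanceAs (Finite Unit)
  | seq p q hp hq => exact inferInstanceAs (Finite (Lab p ⊕ Lab q))
  | case r f h =>
    have := h
    exact inferInstanceAs (Finite (Option (Σ o, Lab (f o))))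
  | loop r b p h => exact inferInstanceAs (Finite (Option (Lab p)))

/-- The label at which a compiled program starts. -/
def entry : (p : Prog) → Lab p
  | .push _ _ => ()
  | .pop _ => ()
  | .seq p _ => Sum.inl (entry p)
  | .case _ _ => none
  | .loop _ _ _ => none

/-- The stacks of the machine: input, output, and work stacks. -/
inductive Stk : Type where
  | inp
  | out
  | reg (r : Reg)
  deriving DecidableEq

instance : Fintype Stk :=
  ⟨{.inp, .out} ∪ Finset.univ.image Stk.reg, by rintro (_ | _ | _) <;> simp⟩

/-- The alphabets of the stacks, for the input alphabet `I`. -/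
@[reducible]
def Alph (I : Type) : Stk → Type
  | .inp => I
  | .out => Bool
  | .reg _ => Tok

/-- The internal state stores the symbols that were read last. -/
abbrev Mem (I : Type) : Type := Option Tok × Option I

variable {I : Type}

/-- The statements of a compiled program that continues at `next`. -/
def code {Λ : Type} : (p : Prog) → (Lab p → Λ) → Λ → Lab p → TM2.Stmt (Alph I) Λ (Mem I)
  | .push r a, _, next => fun _ => .push (.reg r) (fun _ => a) (.goto fun _ => next)
  | .pop r, _, next => fun _ => .pop (.reg r) (fun v _ => v) (.goto fun _ => next)
  | .seq p q, emb, next => fun l =>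
      Sum.elim (code p (fun l => emb (.inl l)) (emb (.inr (entry q))))
        (code q (fun l => emb (.inr l)) next) l
  | .case r f, emb, next => fun l =>
      match l with
      | none => .peek (.reg r) (fun v o => (o, v.2))
          (.goto fun v => emb (some ⟨v.1, entry (f v.1)⟩))
      | some l => code (f l.1) (fun l' => emb (some ⟨l.1, l'⟩)) next l.2
  | .loop r b p, emb, next => fun l =>
      match l with
      | none => .peek (.reg r) (fun v o => (o, v.2))
          (.goto fun v => bif b v.1 then emb (some (entry p)) else next)
      | some l => code p (fun l => emb (some l)) (emb none) l

/-- The stacks of the machine, given the input, the output and the work stacks. -/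
def contents (i : List I) (o : List Bool) (s : Store) : ∀ k, List (Alph I k)
  | .inp => i
  | .out => o
  | .reg r => s r

theorem update_contents_reg (i : List I) (o : List Bool) (s : Store) (r : Reg) (x : List Tok) :
    Function.update (contents i o s) (.reg r) x = contents i o (Function.update s r x) := by
  funext k
  rcases k with _ | _ | r'
  · rfl
  · rfl
  · by_cases h : r' = r
    · subst h
      exact (Function.update_self ..).trans
        (show Function.update s r' x r' = x from Function.update_self ..).symm
    · exact (Function.update_of_ne (by simpa using h) ..).trans
        (Function.update_of_ne h ..).symm

theorem update_contents_inp (i : List I) (o : List Bool) (s : Store) (x : List I) :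
    Function.update (contents i o s) .inp x = contents x o s := by
  funext k
  rcases k with _ | _ | r'
  · exact Function.update_self ..
  · rfl
  · rfl

theorem update_contents_out (i : List I) (o : List Bool) (s : Store) (x : List Bool) :
    Function.update (contents i o s) .out x = contents i x s := by
  funext k
  rcases k with _ | _ | r'
  · rfl
  · exact Function.update_self ..
  · rfl

/-- `n` steps of a `TM2` machine lead from `c` to `c'`. -/
def Steps {Λ : Type} (M : Λ → TM2.Stmt (Alph I) Λ (Mem I)) (c : TM2.Cfg (Alph I) Λ (Mem I)) (n : ℕ)
    (c' : TM2.Cfg (Alph I) Λ (Mem I)) : Prop :=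
  (flip bind (TM2.step M))^[n] (some c) = some c'

section

variable {Λ : Type} {M : Λ → TM2.Stmt (Alph I) Λ (Mem I)}

theorem Steps.trans {a b c : TM2.Cfg (Alph I) Λ (Mem I)} {m n : ℕ} (h₁ : Steps M a m b)
    (h₂ : Steps M b n c) : Steps M a (m + n) c := by
  unfold Steps at *
  rw [add_comm, Function.iterate_add_apply, h₁, h₂]

theorem Steps.one {l : Λ} {v : Mem I} {S : ∀ k, List (Alph I k)}
    {c : TM2.Cfg (Alph I) Λ (Mem I)}
    (h : TM2.stepAux (M l) v S = c) : Steps M ⟨some l, v, S⟩ 1 c := by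
  subst h; rfl

theorem code_case_none (r : Reg) (f : Option Tok → Prog) (emb : Lab (.case r f) → Λ) (next : Λ) :
    code (I := I) (.case r f) emb next none = .peek (.reg r) (fun v o => (o, v.2))
      (.goto fun v => emb (some ⟨v.1, entry (f v.1)⟩)) := by
  rw [code]

theorem code_case_some (r : Reg) (f : Option Tok → Prog) (emb : Lab (.case r f) → Λ) (next : Λ)
    (o : Option Tok) (l : Lab (f o)) :
    code (I := I) (.case r f) emb next (some ⟨o, l⟩) =
      code (f o) (fun l => emb (some ⟨o, l⟩)) next l := by
  rw [code]

theorem Steps.of_code {l : Λ} {q : TM2.Stmt (Alph I) Λ (Mem I)} (hq : M l = q) {v : Mem I}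
    {S : ∀ k, List (Alph I k)} {c : TM2.Cfg (Alph I) Λ (Mem I)} (h : TM2.stepAux q v S = c) :
    Steps M ⟨some l, v, S⟩ 1 c :=
  Steps.one (hq ▸ h)

/-- Every step charged by `Exec` is exactly one machine step; in particular a test is one `peek`
with its `goto`. Since `M` is constrained only on the labels embedded by `emb`, the induction
applies to subprograms inside a larger machine. The final memory is left open because every test
reads its stack afresh. -/
theorem Exec.steps {p : Prog} {s : Store} {t : ℕ} {s' : Store} (h : Exec p s t s')
    (emb : Lab p → Λ) (next : Λ) (hM : ∀ l, M (emb l) = code p emb next l) (i : List I)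
    (o : List Bool) (v : Mem I) :
    ∃ v', Steps M ⟨some (emb (entry p)), v, contents i o s⟩ t
      ⟨some next, v', contents i o s'⟩ := by
  induction h generalizing v next with
  | push r a s =>
    refine ⟨v, Steps.of_code (hM _) ?_⟩
    rw [← update_contents_reg]
    rfl
  | pop r s =>
    refine ⟨v, Steps.of_code (hM _) ?_⟩
    rw [← update_contents_reg]
    rfl
  | seq _ _ ih₁ ih₂ =>
    obtain ⟨v₁, h₁⟩ := ih₁ (fun l => emb (.inl l)) (emb (.inr (entry _))) (fun l => hM (.inl l)) v
    obtain ⟨v₂, h₂⟩ := ih₂ (fun l => emb (.inr l)) next (fun l => hM (.inr l)) v₁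
    exact ⟨v₂, h₁.trans h₂⟩
  | @case r f s t s' _ ih =>
    obtain ⟨v₂, h₂⟩ := ih (fun l => emb (some ⟨_, l⟩)) next
      (fun l => (hM (some ⟨_, l⟩)).trans (code_case_some ..)) ((s r).head?, v.2)
    exact ⟨v₂, Steps.trans (Steps.of_code ((hM none).trans (code_case_none ..)) rfl) h₂⟩
  | @loop_done r b p s hb =>
    refine ⟨((s r).head?, v.2), Steps.of_code (hM _) ?_⟩
    have hc : (bif b (s r).head? then emb (some (entry p)) else next) = next := by rw [hb]; rfl
    exact congrArg (fun l => (⟨some l, ((s r).head?, v.2), contents i o s⟩ :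
      TM2.Cfg (Alph I) Λ (Mem I))) hc
  | @loop_step r b p s t s' t' s'' hb _ _ ih₁ ih₂ =>
    obtain ⟨v₁, h₁⟩ := ih₁ (fun l => emb (some l)) (emb none) (fun l => hM (some l))
      ((s r).head?, v.2)
    obtain ⟨v₂, h₂⟩ := ih₂ emb next hM v₁
    refine ⟨v₂, Steps.trans (Steps.trans (Steps.of_code (hM _) ?_) h₁) h₂⟩
    have hc : (bif b (s r).head? then emb (some (entry p)) else next) = emb (some (entry p)) := by
      rw [hb]; rfl
    exact congrArg (fun l => (⟨some l, ((s r).head?, v.2), contents i o s⟩ :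
      TM2.Cfg (Alph I) Λ (Mem I))) hc

end

end TreeMachine

/-! ### Programs on trees and polynomial-time tree transformations. -/

namespace TreeMachine

/-! ### Trees and their prefix code -/

/-- Binary trees, the universal data type. -/
inductive T : Type where
  | leaf
  | node (l r : T)

/-- The prefix code of a tree. -/
def T.toks : T → List Tok
  | .leaf => [.leaf]
  | .node l r => .node :: (l.toks ++ r.toks)

/-- The size of a tree. -/
def T.size : T → ℕ
  | .leaf => 1
  | .node l r => l.size + r.size + 1

theorem T.length_toks (t : T) : t.toks.length = t.size := by
  induction t with
  | leaf => rfl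
  | node l r hl hr => simp [toks, size, hl, hr]

theorem T.one_le_size (t : T) : 1 ≤ t.size := by cases t <;> simp [size]

/-- A tree's word determines its own end, so trees can lie on a stack without separators. The tails
`u`, `v` let the induction cut off the left subtree first. -/
theorem T.toks_append_inj {s t : T} {u v : List Tok} (h : s.toks ++ u = t.toks ++ v) :
    s = t ∧ u = v := by
  induction s generalizing t u v with
  | leaf => cases t <;> simp_all [toks]
  | node l r hl hr =>
    cases t with
    | leaf => simp [toks] at h
    | node l' r' =>
      simp only [toks, List.cons_append, List.append_assoc, List.cons.injEq, true_and] at h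
      obtain ⟨rfl, h'⟩ := hl h
      obtain ⟨rfl, h''⟩ := hr h'
      exact ⟨rfl, h''⟩

theorem T.toks_inj {s t : T} : s.toks = t.toks ↔ s = t :=
  ⟨fun h => (T.toks_append_inj (u := []) (v := []) (by simpa using h)).1, fun h => h ▸ rfl⟩

/-- A word without markers. -/
def Plain (l : List Tok) : Prop := ∀ x ∈ l, x ≠ .mark

theorem T.plain (t : T) : Plain t.toks := by
  induction t with
  | leaf => simp [Plain, toks]
  | node l r hl hr =>
    intro x hx
    simp only [toks, List.mem_cons, List.mem_append] at hx
    rcases hx with rfl | hx | hx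
    · simp
    · exact hl x hx
    · exact hr x hx

theorem Plain.reverse {l : List Tok} (h : Plain l) : Plain l.reverse := fun x hx =>
  h x (List.mem_reverse.1 hx)

theorem Plain.of_cons {x : Tok} {l : List Tok} (h : Plain (x :: l)) : Plain l := fun y hy =>
  h y (List.mem_cons_of_mem _ hy)

/-- The tree of a truth value. -/
def T.ofBool : Bool → T
  | true => .node .leaf .leaf
  | false => .leaf

/-! ### Bounded runs -/

/-- The store with the given stacks. -/
def mk (a b c d : List Tok) : Store
  | .A => a
  | .B => b
  | .C => c
  | .D => d

section

variable (a b c d x : List Tok)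

@[simp] theorem mk_A : mk a b c d .A = a := rfl
@[simp] theorem mk_B : mk a b c d .B = b := rfl
@[simp] theorem mk_C : mk a b c d .C = c := rfl
@[simp] theorem mk_D : mk a b c d .D = d := rfl
@[simp] theorem update_mk_A : Function.update (mk a b c d) .A x = mk x b c d := by
  funext r; cases r <;> simp [mk, Function.update]
@[simp] theorem update_mk_B : Function.update (mk a b c d) .B x = mk a x c d := by
  funext r; cases r <;> simp [mk, Function.update]
@[simp] theorem update_mk_C : Function.update (mk a b c d) .C x = mk a b x d := by
  funext r; cases r <;> simp [mk, Function.update]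
@[simp] theorem update_mk_D : Function.update (mk a b c d) .D x = mk a b c x := by
  funext r; cases r <;> simp [mk, Function.update]

end

/-- `p` leads from `s` to `s'` in at most `n` steps. -/
def Runs (p : Prog) (s : Store) (n : ℕ) (s' : Store) : Prop := ∃ t ≤ n, Exec p s t s'

theorem Runs.mono {p s m n s'} (h : Runs p s m s') (hmn : m ≤ n) : Runs p s n s' :=
  let ⟨t, ht, e⟩ := h
  ⟨t, ht.trans hmn, e⟩

theorem Runs.seq {p q s s' s'' m n} (h₁ : Runs p s m s') (h₂ : Runs q s' n s'') :
    Runs (p.seq q) s (m + n) s'' :=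
  let ⟨_, ht, e⟩ := h₁
  let ⟨_, ht', e'⟩ := h₂
  ⟨_, add_le_add ht ht', .seq e e'⟩

theorem Runs.push {r : Reg} {x : Tok} {s s' : Store} (h : Function.update s r (x :: s r) = s') :
    Runs (.push r x) s 1 s' := h ▸ ⟨1, le_rfl, .push ..⟩

theorem Runs.pop {r : Reg} {s s' : Store} (h : Function.update s r (s r).tail = s') :
    Runs (.pop r) s 1 s' := h ▸ ⟨1, le_rfl, .pop ..⟩

section

variable (x : Tok) (a b c d : List Tok)

theorem Runs.pushA : Runs (.push .A x) (mk a b c d) 1 (mk (x :: a) b c d) := .push (by simp)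
theorem Runs.pushB : Runs (.push .B x) (mk a b c d) 1 (mk a (x :: b) c d) := .push (by simp)
theorem Runs.pushC : Runs (.push .C x) (mk a b c d) 1 (mk a b (x :: c) d) := .push (by simp)
theorem Runs.pushD : Runs (.push .D x) (mk a b c d) 1 (mk a b c (x :: d)) := .push (by simp)
theorem Runs.popA : Runs (.pop .A) (mk (x :: a) b c d) 1 (mk a b c d) := .pop (by simp)
theorem Runs.popC : Runs (.pop .C) (mk a b (x :: c) d) 1 (mk a b c d) := .pop (by simp)
theorem Runs.popD : Runs (.pop .D) (mk a b c (x :: d)) 1 (mk a b c d) := .pop (by simp)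

end

theorem Runs.case {r f s n s'} (o : Option Tok) (ho : (s r).head? = o) (h : Runs (f o) s n s') :
    Runs (.case r f) s (1 + n) s' := by
  subst ho
  obtain ⟨t, ht, e⟩ := h
  exact ⟨_, Nat.add_le_add_left ht 1, .case e⟩

theorem Runs.loop_done {r b p s} (h : b (s r).head? = false) : Runs (.loop r b p) s 1 s :=
  ⟨1, le_rfl, .loop_done h⟩

theorem Runs.loop_step {r b p s s' s'' m n} (h : b (s r).head? = true) (h₁ : Runs p s m s')
    (h₂ : Runs (.loop r b p) s' n s'') : Runs (.loop r b p) s (1 + m + n) s'' :=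
  let ⟨_, ht, e⟩ := h₁
  let ⟨_, ht', e'⟩ := h₂
  ⟨_, by omega, .loop_step h e e'⟩

/-! ### Moving words and trees between the stacks -/

/-- The test for a symbol other than the marker. -/
def isPlain : Option Tok → Bool
  | some .leaf => true
  | some .node => true
  | _ => false

theorem isPlain_some {x : Tok} (h : x ≠ .mark) : isPlain (some x) = true := by
  cases x <;> simp_all [isPlain]

/-- Moves the word above the topmost marker of `X` to `Y`, reversing it; removes the marker. -/
def moveWord (X Y : Reg) : Prog :=
  (Prog.loop X isPlain (.case X fun o => (Prog.pop X).seq (.push Y (o.getD .mark)))).seq (.pop X)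

/-- Four steps per symbol (loop test, case test, pop, push), then the failing test and the removal
of the marker. -/
theorem runs_moveWord {X Y : Reg} (hXY : X ≠ Y) {l r : List Tok} (hl : Plain l) {s s' : Store}
    (hs : s X = l ++ .mark :: r)
    (hs' : Function.update (Function.update s X r) Y (l.reverse ++ s Y) = s') :
    Runs (moveWord X Y) s (4 * l.length + 2) s' := by
  have key : ∀ s : Store, s X = l ++ .mark :: r →
      Runs (.loop X isPlain (.case X fun o => (Prog.pop X).seq (.push Y (o.getD .mark)))) s
        (4 * l.length + 1)
        (Function.update (Function.update s X (.mark :: r)) Y (l.reverse ++ s Y)) := by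
    clear hs hs' s
    induction l with
    | nil =>
      intro s hs
      have : Function.update (Function.update s X (.mark :: r)) Y ([].reverse ++ s Y) = s := by
        rw [← show s X = .mark :: r from hs]; simp
      rw [this]
      exact Runs.loop_done (by rw [hs]; rfl)
    | cons x l ih =>
      intro s hs
      have h := ih hl.of_cons (Function.update (Function.update s X (l ++ .mark :: r)) Y (x :: s Y))
        (by rw [Function.update_of_ne hXY, Function.update_self])
      have h' := Runs.loop_step (s := s) (m := 3) (b := isPlain)
        (by rw [hs]; exact isPlain_some (hl x (by simp)))
        (Runs.case (n := 2) (some x) (by rw [hs]; rfl)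
          (Runs.seq (m := 1) (n := 1) (Runs.pop rfl)
            (Runs.push (by rw [hs, Function.update_of_ne hXY.symm]; rfl)))) h
      convert h'.mono (n := 4 * (x :: l).length + 1) (by simp; omega) using 1
      · funext k
        by_cases hY : k = Y
        · subst hY; simp
        · by_cases hX : k = X
          · subst hX; simp [hY]
          · simp [hY, hX]
  refine ((key s hs).seq (Runs.pop (s' := s') ?_)).mono (by omega)
  rw [← hs']
  funext k
  by_cases hY : k = Y
  · subst hY; simp [hXY.symm]
  · by_cases hX : k = X
    · subst hX; simp [hY]
    · simp [hY, hX]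

theorem runs_moveBA {l : List Tok} (hl : Plain l) (a b c d : List Tok) :
    Runs (moveWord .B .A) (mk a (l ++ .mark :: b) c d) (4 * l.length + 2)
    (mk (l.reverse ++ a) b c d) := runs_moveWord (by simp) hl rfl (by simp)

theorem runs_moveBC {l : List Tok} (hl : Plain l) (a b c d : List Tok) :
    Runs (moveWord .B .C) (mk a (l ++ .mark :: b) c d) (4 * l.length + 2)
    (mk a b (l.reverse ++ c) d) := runs_moveWord (by simp) hl rfl (by simp)

theorem runs_moveBD {l : List Tok} (hl : Plain l) (a b c d : List Tok) :
    Runs (moveWord .B .D) (mk a (l ++ .mark :: b) c d) (4 * l.length + 2)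
    (mk a b c (l.reverse ++ d)) := runs_moveWord (by simp) hl rfl (by simp)

theorem runs_moveDB {l : List Tok} (hl : Plain l) (a b c d : List Tok) :
    Runs (moveWord .D .B) (mk a b c (l ++ .mark :: d)) (4 * l.length + 2)
    (mk a (l.reverse ++ b) c d) := runs_moveWord (by simp) hl rfl (by simp)

/-- Removes the word above the topmost marker of `X`, and the marker. -/
def dropWord (X : Reg) : Prog := (Prog.loop X isPlain (.pop X)).seq (.pop X)

theorem runs_dropWord {X : Reg} {l r : List Tok} (hl : Plain l) {s s' : Store}
    (hs : s X = l ++ .mark :: r) (hs' : Function.update s X r = s') :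
    Runs (dropWord X) s (2 * l.length + 2) s' := by
  have key : ∀ s : Store, s X = l ++ .mark :: r →
      Runs (.loop X isPlain (.pop X)) s (2 * l.length + 1) (Function.update s X (.mark :: r)) := by
    clear hs hs' s
    induction l with
    | nil =>
      intro s hs
      rw [← show s X = .mark :: r from hs, Function.update_eq_self]
      exact Runs.loop_done (by rw [hs]; rfl)
    | cons x l ih =>
      intro s hs
      have h := ih hl.of_cons (Function.update s X (l ++ .mark :: r)) (by simp)
      rw [Function.update_idem] at h
      refine (Runs.loop_step (m := 1) (by rw [hs]; exact isPlain_some (hl x (by simp)))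
        (Runs.pop (by rw [hs]; rfl)) h).mono ?_
      simp; omega
  refine ((key s hs).seq (Runs.pop (s' := s') ?_)).mono (by omega)
  rw [← hs']
  simp

theorem runs_dropB {l : List Tok} (hl : Plain l) (a b c d : List Tok) :
    Runs (dropWord .B) (mk a (l ++ .mark :: b) c d) (2 * l.length + 2) (mk a b c d) :=
  runs_dropWord hl rfl (by simp)

theorem runs_dropC {l : List Tok} (hl : Plain l) (a b c d : List Tok) :
    Runs (dropWord .C) (mk a b (l ++ .mark :: c) d) (2 * l.length + 2) (mk a b c d) :=
  runs_dropWord hl rfl (by simp)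

theorem runs_dropD {l : List Tok} (hl : Plain l) (a b c d : List Tok) :
    Runs (dropWord .D) (mk a b c (l ++ .mark :: d)) (2 * l.length + 2) (mk a b c d) :=
  runs_dropWord hl rfl (by simp)

/-- Moves the word above the topmost marker of `B` to `A` and to `D`, reversing it; removes the
marker. -/
def forkWord : Prog :=
  (Prog.loop .B isPlain (.case .B fun o =>
    (Prog.pop .B).seq ((Prog.push .A (o.getD .mark)).seq (.push .D (o.getD .mark))))).seq (.pop .B)

theorem runs_forkWord {l : List Tok} (hl : Plain l) (a b c d : List Tok) :
    Runs forkWord (mk a (l ++ .mark :: b) c d) (5 * l.length + 2)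
      (mk (l.reverse ++ a) b c (l.reverse ++ d)) := by
  have key : Runs (.loop .B isPlain (.case .B fun o => (Prog.pop .B).seq
      ((Prog.push .A (o.getD .mark)).seq (.push .D (o.getD .mark)))))
      (mk a (l ++ .mark :: b) c d) (5 * l.length + 1)
      (mk (l.reverse ++ a) (.mark :: b) c (l.reverse ++ d)) := by
    induction l generalizing a d with
    | nil => exact Runs.loop_done rfl
    | cons x l ih =>
      have h := ih hl.of_cons (x :: a) (x :: d)
      simp only [List.reverse_cons, List.append_assoc, List.cons_append, List.nil_append]
      refine (Runs.loop_step (m := 4) (isPlain_some (hl x (by simp)))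
        (Runs.case (n := 3) (some x) rfl (Runs.seq (m := 1) (n := 2) (Runs.pop rfl)
          (Runs.seq (m := 1) (n := 1) (Runs.push rfl) (Runs.push ?_)))) h).mono ?_
      · simp
      · simp; omega
  exact (key.seq (Runs.pop (by simp))).mono (by omega)

/-- Moves as many trees from `A` to `B` as there are symbols on top of `C`, reversing them. -/
def moveTrees : Prog :=
  .loop .C (fun o => o == some .node) (.case .A fun o =>
    (Prog.pop .A).seq ((Prog.push .B (o.getD .mark)).seq
      (if o = some .node then .push .C .node else .pop .C)))

/-- The `node` symbols on `C` count the trees still to be read: a `leaf` completes one, and a `node`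
replaces one by two. The statement is in continuation form, so that the runs for the two subtrees
chain as `hl (hr h)`. -/
theorem runs_moveTrees (t : T) {a b c d : List Tok} {n : ℕ} {s' : Store}
    (h : Runs moveTrees (mk a (t.toks.reverse ++ b) c d) n s') :
    Runs moveTrees (mk (t.toks ++ a) b (.node :: c) d) (n + 5 * t.size) s' := by
  induction t generalizing a b c n with
  | leaf =>
    refine (Runs.loop_step (m := 4) (by rfl) (Runs.case (n := 3) (some .leaf) rfl
      (Runs.seq (m := 1) (n := 2) (Runs.pop rfl) (Runs.seq (m := 1) (n := 1) (Runs.push rfl)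
        (Runs.pop ?_)))) h).mono (by simp [T.size]; omega)
    simp [T.toks]
  | node l r hl hr =>
    simp only [T.toks, List.reverse_cons, List.reverse_append, List.append_assoc, List.cons_append,
      List.nil_append] at h ⊢
    refine (Runs.loop_step (m := 4) (by rfl) (Runs.case (n := 3) (some .node) rfl
      (Runs.seq (m := 1) (n := 2) (Runs.pop rfl) (Runs.seq (m := 1) (n := 1) (Runs.push rfl)
        (Runs.push ?_)))) (hl (hr h))).mono (by simp [T.size]; omega)
    simp

/-- Moves a tree from `A` to `B`, reversing it, above a new marker. -/
def stash : Prog :=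
  (Prog.push .B .mark).seq ((Prog.push .C .mark).seq ((Prog.push .C .node).seq
    (moveTrees.seq (.pop .C))))

theorem runs_stash (t : T) (a b c d : List Tok) :
    Runs stash (mk (t.toks ++ a) b c d) (5 * t.size + 5)
      (mk a (t.toks.reverse ++ .mark :: b) c d) :=
  (Runs.seq (Runs.push rfl) (Runs.seq (Runs.push rfl) (Runs.seq (Runs.push rfl)
    (Runs.seq (s' := mk a (t.toks.reverse ++ .mark :: b) (.mark :: c) d) (m := 1 + 5 * t.size)
      (by simpa using runs_moveTrees t (Runs.loop_done (by rfl)))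
      (Runs.pop (by simp)))))).mono (by omega)

/-- Moves a stashed tree back. -/
def unstash : Prog := moveWord .B .A

theorem runs_unstash (t : T) (a b c d : List Tok) :
    Runs unstash (mk a (t.toks.reverse ++ .mark :: b) c d) (4 * t.size + 2)
      (mk (t.toks ++ a) b c d) := by
  simpa [unstash, T.length_toks] using runs_moveBA t.plain.reverse a b c d

/-- Removes a tree from `A`. -/
def dropTree : Prog := stash.seq (dropWord .B)

theorem runs_dropTree (t : T) (a b c d : List Tok) :
    Runs dropTree (mk (t.toks ++ a) b c d) (7 * t.size + 7) (mk a b c d) := by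
  refine ((runs_stash t a b c d).seq (runs_dropB t.plain.reverse _ _ _ _)).mono ?_
  simp [T.length_toks]; omega

/-- Stashes a copy of a tree. -/
def save : Prog :=
  stash.seq ((Prog.push .D .mark).seq (forkWord.seq ((Prog.push .B .mark).seq (moveWord .D .B))))

/-- The fork restores the stashed tree on `A` and leaves a second copy on `D`; the last move puts
that copy, reversed, on `B` above a fresh marker. -/
theorem runs_save (t : T) (a b c d : List Tok) :
    Runs save (mk (t.toks ++ a) b c d) (14 * t.size + 11)
      (mk (t.toks ++ a) (t.toks.reverse ++ .mark :: b) c d) := by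
  have h := (runs_stash t a b c d).seq ((Runs.pushD .mark _ _ _ _).seq
    ((runs_forkWord t.plain.reverse a b c (.mark :: d)).seq ((Runs.pushB .mark _ _ _ _).seq
      (runs_moveDB t.plain.reverse.reverse _ _ _ _))))
  rw [List.reverse_reverse] at h
  refine h.mono ?_
  simp [T.length_toks]; omega

/-- Pushes a word. -/
def pushWord : List Tok → Prog
  | [] => (Prog.push .A .mark).seq (.pop .A)
  | x :: l => (pushWord l).seq (.push .A x)

theorem runs_pushWord (l a b c d : List Tok) :
    Runs (pushWord l) (mk a b c d) (l.length + 2) (mk (l ++ a) b c d) := by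
  induction l with
  | nil => exact (Runs.push rfl).seq (Runs.pop (by simp))
  | cons x l ih => exact (ih.seq (Runs.push (by simp))).mono (by simp)

/-! ### Comparing trees -/

/-- Compares the words above the topmost markers of `C` and `D`; afterwards, `C` and `D` have
markers on top, except that `D` does not if the words are different. -/
def compareWords : Prog :=
  .loop .C isPlain (.case .C fun x => .case .D fun y =>
    if x = y then (Prog.pop .C).seq (.pop .D)
    else (dropWord .C).seq ((Prog.push .C .mark).seq (.push .D .node)))

/-- The residue `r` on `D` records the outcome. At a mismatch an extra `node` is pushed, which makes
the residue nonempty even if the second word is exhausted and explains the `+ 1`. -/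
theorem runs_compareWords {l m : List Tok} (hl : Plain l) (hm : Plain m) (a b c d : List Tok) :
    ∃ r, Plain r ∧ r.length ≤ m.length + 1 ∧ (r = [] ↔ l = m) ∧
      Runs compareWords (mk a b (l ++ .mark :: c) (m ++ .mark :: d)) (5 * l.length + 10)
        (mk a b (.mark :: c) (r ++ .mark :: d)) := by
  induction l generalizing m with
  | nil =>
    exact ⟨m, hm, by omega, by simp [eq_comm], (Runs.loop_done rfl).mono (by omega)⟩
  | cons x l ih =>
    have hx : isPlain (some x) = true := isPlain_some (hl x (by simp))
    by_cases h : ∃ m', m = x :: m'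
    · obtain ⟨m, rfl⟩ := h
      obtain ⟨r, h₁, h₂, h₃, h₄⟩ := ih hl.of_cons hm.of_cons
      refine ⟨r, h₁, h₂.trans (by simp), by simp [h₃], ?_⟩
      refine (Runs.loop_step hx (Runs.case (some x) rfl (Runs.case (some x) rfl
        (n := 2) ?_)) h₄).mono ?_
      · rw [if_pos rfl]
        exact (Runs.popC _ _ _ _ _).seq (Runs.popD _ _ _ _ _)
      · simp; omega
    · refine ⟨.node :: m, ?_, by simp, ?_, ?_⟩
      · intro y hy
        rcases List.mem_cons.1 hy with rfl | hy
        · simp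
        · exact hm y hy
      · simp only [reduceCtorEq, false_iff]
        exact fun h' => h ⟨l, h'.symm⟩
      · refine (Runs.loop_step hx (Runs.case (some x) rfl (Runs.case (m ++ .mark :: d).head? rfl
          (n := 2 * (x :: l).length + 2 + 2) ?_)) (Runs.loop_done (s := mk a b (.mark :: c) _)
            rfl)).mono ?_
        · rw [if_neg]
          · exact (runs_dropC hl _ _ _ _).seq ((Runs.pushC _ _ _ _ _).seq
              (Runs.pushD _ _ _ _ _))
          · rcases m with _ | ⟨y, m⟩
            · have := hl x (by simp)
              simpa using this
            · simp only [List.cons_append, List.head?_cons, Option.some.injEq]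
              rintro rfl
              exact h ⟨m, rfl⟩
        · simp; omega

/-- Replaces a pair of trees by the truth value of their equality. -/
def compareTrees : Prog :=
  ((Prog.pop .A).seq (stash.seq (stash.seq ((Prog.push .D .mark).seq ((moveWord .B .D).seq
    ((Prog.push .C .mark).seq (moveWord .B .C))))))).seq (compareWords.seq ((Prog.pop .C).seq
      (.case .D fun o => (dropWord .D).seq
        (pushWord (T.ofBool (decide (o = some .mark))).toks))))

theorem runs_compareTrees (s t : T) (a b c d : List Tok) :
    Runs compareTrees (mk ((T.node s t).toks ++ a) b c d) (30 * (T.node s t).size + 50)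
      (mk ((T.ofBool (decide (s.toks = t.toks))).toks ++ a) b c d) := by
  obtain ⟨r, h₁, h₂, h₃, h₄⟩ := runs_compareWords s.plain t.plain a b c d
  have hd : decide ((r ++ .mark :: d).head? = some .mark) = decide (s.toks = t.toks) := by
    rw [decide_eq_decide, ← h₃]
    rcases r with _ | ⟨y, r⟩
    · simp
    · have := h₁ y (by simp)
      simpa using this
  have h := (Runs.popA .node (s.toks ++ (t.toks ++ a)) b c d).seq
    ((runs_stash s _ _ _ _).seq ((runs_stash t _ _ _ _).seq ((Runs.pushD .mark _ _ _ _).seq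
      ((runs_moveBD t.plain.reverse _ _ _ _).seq ((Runs.pushC .mark _ _ _ _).seq
        (runs_moveBC s.plain.reverse _ _ _ _))))))
  have h' := (Runs.popC .mark a b c (r ++ .mark :: d)).seq (Runs.case (r := .D)
    (f := fun o => (dropWord .D).seq (pushWord (T.ofBool (decide (o = some .mark))).toks)) _ rfl
      ((runs_dropD h₁ _ _ _ _).seq (runs_pushWord _ _ _ _ _)))
  rw [List.reverse_reverse, List.reverse_reverse] at h
  rw [mk_D, hd] at h'
  have hs : ∀ b, (T.ofBool b).size ≤ 3 := by rintro (_ | _) <;> simp [T.ofBool, T.size]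
  have := hs (decide (s.toks = t.toks))
  have h'' := h.seq (h₄.seq h')
  simp only [T.toks, List.cons_append, List.append_assoc]
  refine h''.mono ?_
  simp only [T.length_toks, List.length_reverse, T.size] at *
  omega

/-! ### Polynomial-time transformations of trees -/

/-- Natural coefficients make polynomials monotone, so size bounds can be substituted into time
bounds. -/
theorem eval_mono (P : Polynomial ℕ) {m n : ℕ} (h : m ≤ n) : P.eval m ≤ P.eval n := by
  induction P using Polynomial.induction_on' with
  | add p q hp hq => simpa using add_le_add hp hq
  | monomial k a => simpa using Nat.mul_le_mul_left a (Nat.pow_le_pow_left h k)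

/-- `PF e₁ e₂`: some program turns the tree `e₁ i` into `e₂ i`, for all `i`, in polynomial time. -/
def PF {ι : Type} (e₁ e₂ : ι → T) : Prop :=
  ∃ (p : Prog) (P : Polynomial ℕ), ∀ i, (e₂ i).size ≤ P.eval (e₁ i).size ∧
    ∀ a b c d, Runs p (mk ((e₁ i).toks ++ a) b c d) (P.eval (e₁ i).size)
      (mk ((e₂ i).toks ++ a) b c d)

namespace PF

variable {ι κ : Type} {e f g : ι → T}

open Polynomial in
theorem refl (e : ι → T) : PF e e :=
  ⟨pushWord [], X + 2, fun i => ⟨by simp, fun a b c d =>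
    (runs_pushWord [] _ b c d).mono (by simp)⟩⟩

/-- This is where the size bound in `PF` is needed: the second program runs on an input of size at
most `P n`, hence in time `Q (P n)`. -/
theorem trans (h₁ : PF e f) (h₂ : PF f g) : PF e g := by
  obtain ⟨p, P, h₁⟩ := h₁
  obtain ⟨q, Q, h₂⟩ := h₂
  refine ⟨p.seq q, P + Q.comp P, fun i => ⟨?_, fun a b c d => ?_⟩⟩
  · have := (h₂ i).1.trans (eval_mono Q (h₁ i).1)
    simp only [Polynomial.eval_add, Polynomial.eval_comp]
    omega
  · refine (((h₁ i).2 a b c d).seq ((h₂ i).2 a b c d)).mono ?_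
    have := eval_mono Q (h₁ i).1
    simp only [Polynomial.eval_add, Polynomial.eval_comp]
    omega

theorem comap (h : PF e f) (φ : κ → ι) : PF (fun i => e (φ i)) (fun i => f (φ i)) :=
  let ⟨p, P, h⟩ := h
  ⟨p, P, fun i => h (φ i)⟩

open Polynomial in
theorem const (e : ι → T) (t : T) : PF e (fun _ => t) := by
  refine ⟨dropTree.seq (pushWord t.toks), 7 * X + C t.size + 9, fun i => ⟨?_, fun a b c d => ?_⟩⟩
  · simp; omega
  · refine ((runs_dropTree (e i) a b c d).seq (runs_pushWord t.toks a b c d)).mono ?_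
    simp [T.length_toks]; omega

-- The argument is kept on `B` while `g` is computed, then restored above that result to compute
-- `f`. Programs leave whatever lies below their argument untouched, so the first result survives.
open Polynomial in
theorem pair (hf : PF e f) (hg : PF e g) : PF e (fun i => .node (f i) (g i)) := by
  obtain ⟨p, P, hf⟩ := hf
  obtain ⟨q, Q, hg⟩ := hg
  refine ⟨save.seq (q.seq (unstash.seq (p.seq (.push .A .node)))), 18 * X + P + Q + 14,
    fun i => ⟨?_, fun a b c d => ?_⟩⟩
  · have h₁ := (hf i).1
    have h₂ := (hg i).1
    simp [T.size]; omega
  · simp only [T.toks, List.cons_append, List.append_assoc]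
    refine ((runs_save (e i) a b c d).seq (((hg i).2 _ _ _ _).seq
      ((runs_unstash (e i) _ _ _ _).seq (((hf i).2 _ _ _ _).seq
        (Runs.pushA _ _ _ _ _))))).mono ?_
    simp; omega

open Polynomial in
theorem fst (f g : ι → T) : PF (fun i => .node (f i) (g i)) f := by
  refine ⟨(Prog.pop .A).seq (stash.seq (dropTree.seq unstash)), 9 * X + 7 * X + 15,
    fun i => ⟨?_, fun a b c d => ?_⟩⟩
  · simp [T.size]; omega
  · simp only [T.toks, List.cons_append, List.append_assoc]
    refine ((Runs.popA _ _ _ _ _).seq ((runs_stash (f i) _ b c d).seq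
      ((runs_dropTree (g i) _ _ c d).seq (runs_unstash (f i) _ _ _ _)))).mono ?_
    simp [T.size]; omega

open Polynomial in
theorem snd (f g : ι → T) : PF (fun i => .node (f i) (g i)) g := by
  refine ⟨(Prog.pop .A).seq dropTree, 7 * X + 15, fun i => ⟨?_, fun a b c d => ?_⟩⟩
  · simp [T.size]; omega
  · simp only [T.toks, List.cons_append, List.append_assoc]
    refine ((Runs.popA _ _ _ _ _).seq (runs_dropTree (f i) _ b c d)).mono ?_
    simp [T.size]; omega

open Polynomial in
theorem eq (f g : ι → T) [∀ i, Decidable (f i = g i)] :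
    PF (fun i => .node (f i) (g i)) (fun i => .ofBool (decide (f i = g i))) := by
  refine ⟨compareTrees, 30 * X + 50, fun i => ⟨?_, fun a b c d => ?_⟩⟩
  · by_cases h : f i = g i <;> simp [h, T.ofBool, T.size]
  · have := runs_compareTrees (f i) (g i) a b c d
    simpa [T.toks_inj] using this

open Polynomial in
/-- Definition by cases. -/
theorem ite {c : ι → Bool} (hc : PF e (fun i => .ofBool (c i)))
    (ht : PF (fun i : {i // c i = true} => e i) (fun i => f i))
    (hf : PF (fun i : {i // c i = false} => e i) (fun i => f i)) : PF e f := by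
  obtain ⟨p, P, hc⟩ := hc
  obtain ⟨q, Q, ht⟩ := ht
  obtain ⟨r, R, hf⟩ := hf
  refine ⟨save.seq (p.seq (.case .A fun o => if o = some .node then
    dropTree.seq (unstash.seq q) else dropTree.seq (unstash.seq r))),
    18 * X + P + Q + R + 50, fun i => ⟨?_, fun a b c' d => ?_⟩⟩
  · by_cases h : c i = true
    · have := (ht ⟨i, h⟩).1
      simp at this ⊢; omega
    · have := (hf ⟨i, by simpa using h⟩).1
      simp at this ⊢; omega
  · by_cases h : c i = true
    · refine ((runs_save (e i) a b c' d).seq (((hc i).2 _ _ _ _).seq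
        (Runs.case (some .node) (by simp [h, T.ofBool, T.toks]) ((runs_dropTree _ _ _ _ _).seq
          ((runs_unstash (e i) _ _ _ _).seq ((ht ⟨i, h⟩).2 _ _ _ _)))))).mono ?_
      simp [h, T.ofBool, T.size]; omega
    · have h : c i = false := by simpa using h
      refine ((runs_save (e i) a b c' d).seq (((hc i).2 _ _ _ _).seq
        (Runs.case (some .leaf) (by simp [h, T.ofBool, T.toks]) ((runs_dropTree _ _ _ _ _).seq
          ((runs_unstash (e i) _ _ _ _).seq ((hf ⟨i, h⟩).2 _ _ _ _)))))).mono ?_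
      simp [h, T.ofBool, T.size]; omega

open Polynomial in
/-- Iteration; `s i j` is the state after `j` rounds, and there are `N i` rounds. -/
theorem loop {s : ι → ℕ → T} {N : ι → ℕ} (B : Polynomial ℕ)
    (hc : PF (fun x : {x : ι × ℕ // x.2 ≤ N x.1} => s x.1.1 x.1.2)
      (fun x => .ofBool (decide (x.1.2 < N x.1.1))))
    (hf : PF (fun x : {x : ι × ℕ // x.2 < N x.1} => s x.1.1 x.1.2)
      (fun x => s x.1.1 (x.1.2 + 1)))
    (hN : ∀ i, N i ≤ B.eval (s i 0).size)
    (hs : ∀ i j, j ≤ N i → (s i j).size ≤ B.eval (s i 0).size) :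
    PF (fun i => s i 0) (fun i => s i (N i)) := by
  obtain ⟨p, P, hc⟩ := hc
  obtain ⟨q, Q, hf⟩ := hf
  let body : Prog := dropTree.seq (unstash.seq (q.seq (save.seq p)))
  -- `W` bounds one round of `body`. A round starts with the last truth value on `A` and the current
  -- state stashed on `B`; all states have size at most `B` evaluated at the initial size.
  let W : Polynomial ℕ := 18 * B + P.comp B + Q.comp B + 50
  have hc' : ∀ i j, j ≤ N i → ∀ a b c d, Runs p (mk ((s i j).toks ++ a) b c d)
      (P.eval (s i j).size) (mk ((T.ofBool (decide (j < N i))).toks ++ a) b c d) :=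
    fun i j hj => (hc ⟨(i, j), hj⟩).2
  have hf' : ∀ i j, j < N i → ∀ a b c d, Runs q (mk ((s i j).toks ++ a) b c d)
      (Q.eval (s i j).size) (mk ((s i (j + 1)).toks ++ a) b c d) :=
    fun i j hj => (hf ⟨(i, j), hj⟩).2
  have test : ∀ i j, j ≤ N i → ∀ a b c d, Runs (save.seq p) (mk ((s i j).toks ++ a) b c d)
      (14 * (s i j).size + 11 + P.eval (s i j).size)
      (mk ((T.ofBool (decide (j < N i))).toks ++ a)
        ((s i j).toks.reverse ++ .mark :: b) c d) := fun i j hj a b c d =>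
    (runs_save (s i j) a b c d).seq (hc' i j hj a ((s i j).toks.reverse ++ .mark :: b) c d)
  have main : ∀ m i j, j + m = N i → ∀ a b c d, Runs (.loop .A (fun o => o == some .node) body)
      (mk ((T.ofBool (decide (j < N i))).toks ++ a)
        ((s i j).toks.reverse ++ .mark :: b) c d)
      (m * W.eval (s i 0).size + 1)
      (mk (.leaf :: a) ((s i (N i)).toks.reverse ++ .mark :: b) c d) := by
    intro m
    induction m with
    | zero =>
      intro i j hj a b c d
      obtain rfl : j = N i := by omega
      rw [show decide (N i < N i) = false by simp]
      exact (Runs.loop_done (by rfl)).mono (by omega)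
    | succ m ih =>
      intro i j hj a b c d
      have hlt : j < N i := by omega
      refine (Runs.loop_step ?_
        ((runs_dropTree _ _ _ _ _).seq ((runs_unstash (s i j) _ _ _ _).seq
          ((hf' i j hlt _ _ _ _).seq (test i (j + 1) hlt _ _ _ _))))
        (ih i (j + 1) (by omega) _ b c d)).mono ?_
      · rw [decide_eq_true hlt]; rfl
      have h₁ := hs i j hlt.le
      have h₂ := hs i (j + 1) hlt
      have h₃ := eval_mono P h₂
      have h₄ := eval_mono Q h₁
      simp [hlt, T.ofBool, T.size, W, Nat.add_mul]
      omega
  refine ⟨(save.seq p).seq ((Prog.loop .A (fun o => o == some .node) body).seq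
    ((Prog.pop .A).seq unstash)), 18 * B + P.comp B + B * W + 20,
    fun i => ⟨?_, fun a b c d => ?_⟩⟩
  · have := hs i _ le_rfl
    simp; omega
  · refine ((test i 0 (Nat.zero_le _) a b c d).seq ((main (N i) i 0 (by omega) a b c d).seq
      (Runs.seq (Runs.popA _ _ _ _ _) (runs_unstash _ _ _ _ _)))).mono ?_
    have h₁ := hs i _ le_rfl
    have h₂ := hs i 0 (Nat.zero_le _)
    have h₃ := eval_mono P h₂
    have h₄ := Nat.mul_le_mul_right (W.eval (s i 0).size) (hN i)
    simp only [Polynomial.eval_add, Polynomial.eval_mul, Polynomial.eval_comp,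
      Polynomial.eval_ofNat]
    omega

end PF

end TreeMachine

/-! ### Polynomial-time functions on encoded types. -/

namespace TreeMachine

/-! ### Types encoded as trees -/

/-- An injective encoding of a type by trees. -/
class Enc (α : Type) where
  enc : α → T
  inj : Function.Injective enc

instance : Enc Bool := ⟨T.ofBool, by rintro (_ | _) (_ | _) h <;> simp_all [T.ofBool]⟩

instance {α β : Type} [Enc α] [Enc β] : Enc (α × β) :=
  ⟨fun p => .node (Enc.enc p.1) (Enc.enc p.2), by
    rintro ⟨a, b⟩ ⟨c, d⟩ h
    simp only [T.node.injEq] at h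
    exact Prod.ext (Enc.inj h.1) (Enc.inj h.2)⟩

/-- The code of a list. -/
def encList {α : Type} [Enc α] : List α → T
  | [] => .leaf
  | a :: l => .node (Enc.enc a) (encList l)

instance {α : Type} [Enc α] : Enc (List α) := ⟨encList, by
  intro l
  induction l with
  | nil => rintro (_ | ⟨b, m⟩) h <;> simp_all [encList]
  | cons a l ih =>
    rintro (_ | ⟨b, m⟩) h
    · simp [encList] at h
    · simp only [encList, T.node.injEq] at h
      rw [Enc.inj h.1, ih h.2]⟩

/-- The code of a natural number, in unary. -/
def encNat : ℕ → T
  | 0 => .leaf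
  | n + 1 => .node .leaf (encNat n)

theorem encNat_injective : Function.Injective encNat := by
  intro n
  induction n with
  | zero => rintro (_ | m) h <;> simp_all [encNat]
  | succ n ih =>
    rintro (_ | m) h
    · simp [encNat] at h
    · simp only [encNat, T.node.injEq, true_and] at h
      rw [ih h]

/-- An encoding of a finite type. -/
noncomputable abbrev Enc.ofFinite (α : Type) [Finite α] : Enc α :=
  ⟨fun a => encNat (Finite.equivFin α a), fun a b h => by
    exact (Finite.equivFin α).injective (Fin.ext (encNat_injective h))⟩

/-- The size of the code. -/
def size {α : Type} [Enc α] (a : α) : ℕ := (Enc.enc a).size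

section

variable {α β : Type} [Enc α] [Enc β]

theorem size_pair (a : α) (b : β) : size (a, b) = size a + size b + 1 := rfl

theorem size_nil : size ([] : List α) = 1 := rfl

theorem size_cons (a : α) (l : List α) : size (a :: l) = size a + size l + 1 := rfl

theorem one_le_size (a : α) : 1 ≤ size a := T.one_le_size _

theorem size_bool_le (b : Bool) : size b ≤ 3 := by cases b <;> simp [size, Enc.enc, T.ofBool, T.size]

theorem size_append (l m : List α) : size (l ++ m) + 1 = size l + size m := by
  induction l with
  | nil => simp [size_nil]; omega
  | cons a l ih => simp only [List.cons_append, size_cons]; omega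

theorem length_lt_size (l : List α) : l.length < size l := by
  induction l with
  | nil => simp [size_nil]
  | cons a l ih => simp only [List.length_cons, size_cons]; omega

theorem size_sublist_le {l m : List α} (h : l.Sublist m) : size l ≤ size m := by
  induction h with
  | slnil => rfl
  | cons a _ ih => rw [size_cons]; omega
  | cons_cons a _ ih => rw [size_cons, size_cons]; omega

theorem size_mem_lt {l : List α} {a : α} (h : a ∈ l) : size a < size l := by
  induction l with
  | nil => simp at h
  | cons b l ih =>
    rw [size_cons]
    rcases List.mem_cons.1 h with rfl | h
    · omega
    · have := ih h; omega

end

/-! ### Polynomial-time functions -/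

/-- `f` is computed in polynomial time on the codes. -/
def PT {α β : Type} [Enc α] [Enc β] (f : α → β) : Prop :=
  PF (fun a => Enc.enc a) (fun a => Enc.enc (f a))

namespace PT

variable {α β γ δ σ : Type} [Enc α] [Enc β] [Enc γ] [Enc δ] [Enc σ]

theorem size_le {f : α → β} (h : PT f) : ∃ P : Polynomial ℕ, ∀ a, size (f a) ≤ P.eval (size a) :=
  let ⟨_, P, h⟩ := h
  ⟨P, fun a => (h a).1⟩

theorem congr {f g : α → β} (hf : PT f) (h : ∀ a, f a = g a) : PT g := funext h ▸ hf

theorem id : PT (fun a : α => a) := PF.refl _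

theorem comp {f : β → γ} {g : α → β} (hf : PT f) (hg : PT g) : PT (fun a => f (g a)) :=
  PF.trans hg (PF.comap hf g)

theorem const (b : β) : PT (fun _ : α => b) := PF.const _ _

theorem pair {f : α → β} {g : α → γ} (hf : PT f) (hg : PT g) : PT (fun a => (f a, g a)) :=
  PF.pair hf hg

theorem fst {f : α → β × γ} (hf : PT f) : PT (fun a => (f a).1) :=
  PF.trans hf (PF.fst (fun a => Enc.enc (f a).1) (fun a => Enc.enc (f a).2))

theorem snd {f : α → β × γ} (hf : PT f) : PT (fun a => (f a).2) :=
  PF.trans hf (PF.snd (fun a => Enc.enc (f a).1) (fun a => Enc.enc (f a).2))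

theorem cond {c : α → Bool} {f g : α → β} (hc : PT c) (hf : PT f) (hg : PT g) :
    PT (fun a => bif c a then f a else g a) := by
  refine PF.ite (c := c) hc ?_ ?_
  · refine (PF.comap hf Subtype.val).trans ?_
    convert PF.refl _ using 3 with a
    simp [a.2]
  · refine (PF.comap hg Subtype.val).trans ?_
    convert PF.refl _ using 3 with a
    simp [a.2]

theorem not {c : α → Bool} (hc : PT c) : PT (fun a => !(c a)) :=
  (cond hc (const false) (const true)).congr fun a => by cases c a <;> rfl

theorem and {c d : α → Bool} (hc : PT c) (hd : PT d) : PT (fun a => c a && d a) :=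
  (cond hc hd (const false)).congr fun a => by cases c a <;> rfl

theorem or {c d : α → Bool} (hc : PT c) (hd : PT d) : PT (fun a => c a || d a) :=
  (cond hc (const true) hd).congr fun a => by cases c a <;> rfl

theorem eq [DecidableEq β] {f g : α → β} (hf : PT f) (hg : PT g) :
    PT (fun a => decide (f a = g a)) := by
  classical
  refine ((PF.pair hf hg).trans (PF.eq _ _)).trans ?_
  convert PF.refl _ using 3 with a
  exact congrArg T.ofBool (decide_eq_decide.2 Enc.inj.eq_iff.symm)

theorem nil : PT (fun _ : α => ([] : List β)) := const _

theorem cons {f : α → β} {l : α → List β} (hf : PT f) (hl : PT l) : PT (fun a => f a :: l a) :=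
  PF.pair hf hl

/-- Definition by cases on the value of a function with values in a finite type. -/
theorem finite {ι : Type} [Finite ι] [Enc ι] {f : ι → α → β} (hf : ∀ i, PT (f i)) :
    PT (fun p : ι × α => f p.1 p.2) := by
  classical
  have := Fintype.ofFinite ι
  -- The possible values are tested one after another. A failed test leaves only the tail of `L`,
  -- and over the empty list there is no input to treat.
  have key : ∀ L : List ι, PF (fun p : {p : ι × α // p.1 ∈ L} => Enc.enc p.1)
      (fun p => Enc.enc (f p.1.1 p.1.2)) := by
    intro L
    induction L with
    | nil => exact ⟨pushWord [], 0, fun p => absurd p.2 (by simp)⟩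
    | cons i L ih =>
      refine PF.ite (c := fun p => decide (p.1.1 = i)) ?_ ?_ ?_
      · exact PF.comap (eq (f := fun p : ι × α => p.1) (fst id) (const i)) Subtype.val
      · refine (PF.comap ((hf i).comp (snd (f := fun p : ι × α => p) id))
          (fun p : {p : {p : ι × α // p.1 ∈ i :: L} // decide (p.1.1 = i) = true} => p.1.1)).trans ?_
        convert PF.refl _ using 3 with p
        exact congrArg (fun j => f j p.1.1.2) (of_decide_eq_true p.2)
      · exact PF.comap ih (fun p : {p : {p : ι × α // p.1 ∈ i :: L} //
            decide (p.1.1 = i) = false} => ⟨p.1.1, by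
          have h₁ := p.1.2
          have h₂ := of_decide_eq_false p.2
          simpa [h₂] using h₁⟩)
  exact PF.comap (key Finset.univ.toList) (fun p : ι × α => ⟨p, by simp⟩)

theorem finite_comp {ι : Type} [Finite ι] [Enc ι] {f : ι → α → β} {i : α → ι} (hi : PT i)
    (hf : ∀ i, PT (f i)) : PT (fun a => f (i a) a) :=
  (finite hf).comp (pair hi id)

/-! #### Lists -/

/-- Only the empty list has the code `leaf`, so an equality test suffices. -/
theorem isEmpty {l : α → List β} (hl : PT l) : PT (fun a => (l a).isEmpty) := by
  classical
  refine ((PF.pair hl (PF.const _ T.leaf)).trans (PF.eq _ _)).trans ?_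
  convert PF.refl _ using 3 with a
  rcases h : l a with _ | ⟨b, t⟩
  · exact congrArg T.ofBool (by simp [Enc.enc, encList, h])
  · exact congrArg T.ofBool (by simp [Enc.enc, encList, h])

/-- `h` enters only through its two equations, so that functions defined by pattern matching fit. -/
theorem list_cases {l : α → List β} {f : α → γ} {g : α × β × List β → γ} {h : α → γ} (hl : PT l)
    (hf : PT f) (hg : PT g) (h₀ : ∀ a, l a = [] → h a = f a)
    (h₁ : ∀ a b t, l a = b :: t → h a = g (a, b, t)) : PT h := by
  refine PF.ite (c := fun a => (l a).isEmpty) (isEmpty hl) ?_ ?_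
  · refine (PF.comap hf Subtype.val).trans ?_
    convert PF.refl _ using 3 with a
    exact h₀ _ (by simpa using a.2)
  · have : ∀ a : {a // (l a).isEmpty = false}, ∃ b t, l a = b :: t := by
      rintro ⟨a, ha⟩
      rcases h : l a with _ | ⟨b, t⟩
      · simp [h] at ha
      · exact ⟨b, t, rfl⟩
    choose b t hbt using this
    refine (PF.comap (PF.pair (PF.refl _) hl) Subtype.val).trans ?_
    have := PF.comap hg (fun a : {a // (l a).isEmpty = false} => (a.1, b a, t a))
    convert this using 3 with a a
    · show T.node (Enc.enc a.1) (Enc.enc (l a)) = _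
      rw [hbt a]
      rfl
    · exact h₁ _ _ _ (hbt a)

/-- Folds over a list, given a bound for the size of the intermediate results. -/
theorem foldl {l : α → List β} {s : α → σ} {f : α → σ → β → σ} (hl : PT l) (hs : PT s)
    (hf : PT (fun p : α × σ × β => f p.1 p.2.1 p.2.2)) (B : Polynomial ℕ)
    (hB : ∀ a n, size (((l a).take n).foldl (f a) (s a)) ≤ B.eval (size a)) :
    PT (fun a => (l a).foldl (f a) (s a)) := by
  -- The loop state holds the parameter, the accumulator and the unread part of the list; the loop
  -- test is whether that part is nonempty.
  let st : α → ℕ → α × σ × List β := fun a j =>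
    (a, ((l a).take j).foldl (f a) (s a), (l a).drop j)
  have hst : PF (fun a => Enc.enc (st a 0)) (fun a => Enc.enc (st a (l a).length)) := by
    refine PF.loop (s := fun a j => Enc.enc (st a j)) (N := fun a => (l a).length)
      (.X + B + 2) ?_ ?_ ?_ ?_
    · refine (PF.comap (not (isEmpty (snd (snd (f := fun p : α × σ × List β => p) id))))
        (fun x : {x : α × ℕ // x.2 ≤ (l x.1).length} => st x.1.1 x.1.2)).trans ?_
      convert PF.refl _ using 3 with x
      obtain ⟨⟨a, j⟩, hx⟩ := x
      simp only [st, Enc.enc]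
      congr 1
      by_cases h : j < (l a).length
      · have : (l a).drop j ≠ [] := by simpa using h
        simp [h]
      · simp [h, Nat.le_of_not_lt h]
    · have hg : PT (fun p : α × σ × β × List β => (p.1, f p.1 p.2.1 p.2.2.1, p.2.2.2)) :=
        pair (fst id) (pair (hf.comp (pair (fst id) (pair (fst (snd id)) (fst (snd (snd id))))))
          (snd (snd (snd id))))
      have := PF.comap hg (fun x : {x : α × ℕ // x.2 < (l x.1).length} =>
        (x.1.1, ((l x.1.1).take x.1.2).foldl (f x.1.1) (s x.1.1), (l x.1.1)[x.1.2]'x.2,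
          (l x.1.1).drop (x.1.2 + 1)))
      convert this using 3 with x x
      · obtain ⟨⟨a, j⟩, hx⟩ := x
        simp only [st]
        rw [List.drop_eq_getElem_cons hx]
        rfl
      · obtain ⟨⟨a, j⟩, hx⟩ := x
        have hx' : j < (l a).length := hx
        simp only [st]
        rw [List.take_succ_eq_append_getElem hx', List.foldl_append]
        rfl
    · intro a
      have h₁ := length_lt_size (l a)
      have h₂ : (Enc.enc (st a 0)).size = size a + (size (s a) + size (l a) + 1) + 1 := rfl
      simp only [Polynomial.eval_add, Polynomial.eval_X, Polynomial.eval_ofNat]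
      omega
    · intro a j _
      have h₂ : (Enc.enc (st a 0)).size = size a + (size (s a) + size (l a) + 1) + 1 := rfl
      have h₃ : (Enc.enc (st a j)).size = size a + (size (((l a).take j).foldl (f a) (s a)) +
        size ((l a).drop j) + 1) + 1 := rfl
      have h₄ := hB a j
      have h₅ : B.eval (size a) ≤ B.eval (Enc.enc (st a 0)).size := eval_mono B (by omega)
      have h₆ := size_sublist_le (List.drop_sublist j (l a))
      simp only [Polynomial.eval_add, Polynomial.eval_X, Polynomial.eval_ofNat]
      omega
  have h₀ : PF (fun a => Enc.enc a) (fun a => Enc.enc (st a 0)) := by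
    have : PT (fun a => (a, s a, l a)) := pair id (pair hs hl)
    exact this
  refine (h₀.trans hst).trans ((PF.comap (fst (snd (f := fun p : α × σ × List β => p) id))
    (fun a => st a (l a).length)).trans ?_)
  convert PF.refl _ using 3 with a
  simp [st]

/-- Folds over a list; the size of the result may grow additively in each round. -/
theorem foldl_of_growth {l : α → List β} {s : α → σ} {f : α → σ → β → σ} (hl : PT l) (hs : PT s)
    (hf : PT (fun p : α × σ × β => f p.1 p.2.1 p.2.2)) (G : Polynomial ℕ)
    (hG : ∀ a x b, size (f a x b) ≤ size x + G.eval (size (a, b))) :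
    PT (fun a => (l a).foldl (f a) (s a)) := by
  obtain ⟨S, hS⟩ := hs.size_le
  obtain ⟨L, hL⟩ := hl.size_le
  -- `S` bounds the initial value and `L` the number of rounds; an element of the list is smaller
  -- than the list, so `X + L + 1` bounds the size of `(a, b)`.
  refine foldl hl hs hf (S + L * G.comp (.X + L + 1)) fun a n => ?_
  have key : ∀ (m : List β) (x : σ), (∀ b ∈ m, b ∈ l a) →
      size (m.foldl (f a) x) ≤ size x + m.length * G.eval (size a + size (l a) + 1) := by
    intro m
    induction m with
    | nil => intro x _; simp
    | cons b m ih =>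
      intro x hm
      have h₁ := ih (f a x b) fun b hb => hm b (List.mem_cons_of_mem _ hb)
      have h₂ := hG a x b
      have h₃ : G.eval (size (a, b)) ≤ G.eval (size a + size (l a) + 1) := by
        refine eval_mono G ?_
        have := size_mem_lt (hm b (by simp))
        rw [size_pair]; omega
      rw [List.foldl_cons, List.length_cons, Nat.add_mul]
      omega
  refine (key _ _ fun b hb => List.mem_of_mem_take hb).trans ?_
  simp only [Polynomial.eval_add, Polynomial.eval_mul, Polynomial.eval_comp, Polynomial.eval_X,
    Polynomial.eval_one]
  refine add_le_add (hS a) (Nat.mul_le_mul ?_ (eval_mono G ?_))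
  · have := length_lt_size (l a)
    have := hL a
    rw [List.length_take]
    omega
  · have := hL a
    omega

theorem reverse {l : α → List β} (hl : PT l) : PT (fun a => (l a).reverse) := by
  have := foldl_of_growth (f := fun (_ : α) x b => b :: x) hl (nil (β := β))
    (cons (snd (snd id)) (fst (snd id))) (.X + 1) (fun a x b => by
      simp only [size_cons, size_pair, Polynomial.eval_add, Polynomial.eval_X, Polynomial.eval_one]
      omega)
  simpa using this

theorem append {l m : α → List β} (hl : PT l) (hm : PT m) : PT (fun a => l a ++ m a) := by
  have := foldl_of_growth (f := fun (_ : α) x b => b :: x) (reverse hl) hm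
    (cons (snd (snd id)) (fst (snd id))) (.X + 1) (fun a x b => by
      simp only [size_cons, size_pair, Polynomial.eval_add, Polynomial.eval_X, Polynomial.eval_one]
      omega)
  simpa using this

theorem flatMap {l : α → List β} {f : α → β → List γ} (hl : PT l)
    (hf : PT (fun p : α × β => f p.1 p.2)) : PT (fun a => (l a).flatMap (f a)) := by
  obtain ⟨F, hF⟩ := hf.size_le
  have := foldl_of_growth (f := fun a x b => x ++ f a b) hl (nil (β := γ))
    (append (fst (snd id)) (hf.comp (pair (fst id) (snd (snd id))))) F (fun a x b => by
      have h₁ := size_append x (f a b)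
      have h₂ := hF (a, b)
      simp only at h₂
      omega)
  convert this using 2 with a
  have key : ∀ (m : List β) (x : List γ), m.foldl (fun x b => x ++ f a b) x = x ++ m.flatMap (f a) := by
    intro m
    induction m with
    | nil => simp
    | cons b m ih => intro x; simp [ih]
  simp [key]

theorem map {l : α → List β} {f : α → β → γ} (hl : PT l) (hf : PT (fun p : α × β => f p.1 p.2)) :
    PT (fun a => (l a).map (f a)) :=
  (flatMap (f := fun a b => [f a b]) hl (cons hf nil)).congr fun a => by
    induction l a with
    | nil => rfl
    | cons b m ih => rw [List.flatMap_cons, ih]; rfl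

theorem filter {l : α → List β} {p : α → β → Bool} (hl : PT l)
    (hp : PT (fun x : α × β => p x.1 x.2)) : PT (fun a => (l a).filter (p a)) := by
  have := flatMap (f := fun a b => bif p a b then [b] else []) hl
    (cond hp (cons (snd id) nil) nil)
  convert this using 2 with a
  induction l a with
  | nil => rfl
  | cons b m ih => cases h : p a b <;> simp [h, ih]

theorem any {l : α → List β} {p : α → β → Bool} (hl : PT l)
    (hp : PT (fun x : α × β => p x.1 x.2)) : PT (fun a => (l a).any (p a)) :=
  (not (isEmpty (filter hl hp))).congr fun a => by
    rw [Bool.eq_iff_iff]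
    simp

theorem all {l : α → List β} {p : α → β → Bool} (hl : PT l)
    (hp : PT (fun x : α × β => p x.1 x.2)) : PT (fun a => (l a).all (p a)) :=
  (not (any (p := fun a b => !(p a b)) hl (not hp))).congr fun a => by
    rw [Bool.eq_iff_iff]
    simp

theorem mem {x : α → β} {l : α → List β} {_ : ∀ a, Decidable (x a ∈ l a)} (hx : PT x)
    (hl : PT l) : PT (fun a => decide (x a ∈ l a)) := by
  classical
  refine (any (p := fun a b => decide (b = x a)) hl (eq (snd id) (hx.comp (fst id)))).congr
    fun a => ?_
  rw [Bool.eq_iff_iff]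
  simp

end PT

end TreeMachine

/-! ### From polynomial-time functions to languages in P. -/

namespace TreeMachine

open Turing

/-! ### Deciding languages -/

/-- The control labels: start, read an input symbol, push its code, write the answer. -/
abbrev Ctl (I : Type) : Type := Option (Option (Option I))

variable {I : Type}

/-- Pushes a word on `A`. -/
def pushStmt {Λ : Type} : List Tok → TM2.Stmt (Alph I) Λ (Mem I) → TM2.Stmt (Alph I) Λ (Mem I)
  | [], q => q
  | x :: l, q => pushStmt l (.push (.reg .A) (fun _ => x) q)

theorem stepAux_pushStmt {Λ : Type} (l : List Tok) (q : TM2.Stmt (Alph I) Λ (Mem I)) (v : Mem I)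
    (i : List I) (o : List Bool) (a b c d : List Tok) :
    TM2.stepAux (pushStmt l q) v (contents i o (mk a b c d)) =
      TM2.stepAux q v (contents i o (mk (l ++ a) b c d)) := by
  induction l generalizing q with
  | nil => rfl
  | cons x l ih =>
    rw [pushStmt, ih]
    have h := update_contents_reg i o (mk (l ++ a) b c d) .A (x :: (l ++ a))
    rw [update_mk_A] at h
    exact congrArg (TM2.stepAux q v) h

/-- The machine that runs `p` on the code of the reversed input word. -/
def program [Enc I] (p : Prog) : Lab p ⊕ Ctl I → TM2.Stmt (Alph I) (Lab p ⊕ Ctl I) (Mem I)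
  | .inl l => code p .inl (.inr (some none)) l
  | .inr none => .push (.reg .A) (fun _ => .leaf) (.goto fun _ => .inr (some (some none)))
  | .inr (some none) => .peek (.reg .A) (fun v o => (o, v.2)) (.pop (.reg .A) (fun v _ => v)
      (.branch (fun v => v.1 == some .node)
        (.pop (.reg .A) (fun v _ => v) (.pop (.reg .A) (fun v _ => v)
          (.push .out (fun _ => true) (.load (fun _ => (none, none)) .halt))))
        (.push .out (fun _ => false) (.load (fun _ => (none, none)) .halt))))
  | .inr (some (some none)) => .pop .inp (fun v o => (v.1, o))
      (.goto fun v => v.2.elim (.inl (entry p)) fun g => .inr (some (some (some g))))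
  | .inr (some (some (some g))) =>
      pushStmt (.node :: (Enc.enc g).toks) (.goto fun _ => .inr (some (some none)))

/-- Each symbol is put in front of the list built so far, so the word arrives reversed. A symbol
costs two steps, one to read it and one to push its whole code; the last step detects the end of the
input. -/
theorem steps_read [Enc I] (p : Prog) (w u : List I) (v : Mem I) :
    ∃ v', Steps (program p) ⟨some (.inr (some (some none))), v,
      contents w [] (mk (Enc.enc u).toks [] [] [])⟩ (2 * w.length + 1)
      ⟨some (.inl (entry p)), v', contents [] [] (mk (Enc.enc (w.reverse ++ u)).toks [] [] [])⟩ := by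
  induction w generalizing u v with
  | nil =>
    refine ⟨(v.1, none), Steps.one ?_⟩
    have h := update_contents_inp ([] : List I) [] (mk (Enc.enc u).toks [] [] []) []
    exact congrArg (fun S => (⟨some (.inl (entry p)), (v.1, none), S⟩ :
      TM2.Cfg (Alph I) (Lab p ⊕ Ctl I) (Mem I))) h
  | cons g w ih =>
    obtain ⟨v', h⟩ := ih (g :: u) (v.1, some g)
    refine ⟨v', ?_⟩
    have h₁ : Steps (program p) ⟨some (.inr (some (some none))), v,
        contents (g :: w) [] (mk (Enc.enc u).toks [] [] [])⟩ 1
        ⟨some (.inr (some (some (some g)))), (v.1, some g),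
          contents w [] (mk (Enc.enc u).toks [] [] [])⟩ := by
      refine Steps.one ?_
      have h := update_contents_inp (g :: w) [] (mk (Enc.enc u).toks [] [] []) w
      exact congrArg (fun S => (⟨some (.inr (some (some (some g)))), (v.1, some g), S⟩ :
        TM2.Cfg (Alph I) (Lab p ⊕ Ctl I) (Mem I))) h
    have h₂ : Steps (program p) ⟨some (.inr (some (some (some g)))), (v.1, some g),
          contents w [] (mk (Enc.enc u).toks [] [] [])⟩ 1
        ⟨some (.inr (some (some none))), (v.1, some g),
          contents w [] (mk (Enc.enc (g :: u)).toks [] [] [])⟩ :=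
      Steps.one (stepAux_pushStmt _ _ _ _ _ _ _ _ _)
    have h₃ := (h₁.trans h₂).trans h
    rw [List.reverse_cons, List.append_assoc]
    have e : 1 + 1 + (2 * w.length + 1) = 2 * (g :: w).length + 1 := by
      rw [List.length_cons]; omega
    rw [← e]
    exact h₃

/-- The answer is `leaf` or `node leaf leaf`. It is popped completely and the memory is reset,
because the halting configuration must have only the output left. -/
theorem steps_write [Enc I] (p : Prog) (b : Bool) (v : Mem I) :
    Steps (program p) ⟨some (.inr (some none)), v,
      contents [] [] (mk (Enc.enc b).toks [] [] [])⟩ 1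
      ⟨none, (none, none), contents [] [b] (mk [] [] [] [])⟩ := by
  have key : ∀ (a : List Tok), Function.update (contents ([] : List I) [] (mk a [] [] []))
      (.reg .A) a.tail = contents [] [] (mk a.tail [] [] []) := fun a => by
    rw [update_contents_reg, update_mk_A]
  cases b with
  | false =>
    refine Steps.one ?_
    have h₁ := key [.leaf]
    have h₂ := update_contents_out ([] : List I) [] (mk [] [] [] []) [false]
    refine congrArg (fun S => (⟨none, (none, none), S⟩ :
      TM2.Cfg (Alph I) (Lab p ⊕ Ctl I) (Mem I))) (Eq.trans ?_ h₂)
    exact congrArg (fun S : ∀ k, List (Alph I k) => Function.update S .out (false :: S .out)) h₁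
  | true =>
    refine Steps.one ?_
    have h₁ := key [.node, .leaf, .leaf]
    have h₁' := key [.leaf, .leaf]
    have h₁'' := key [.leaf]
    have h₂ := update_contents_out ([] : List I) [] (mk [] [] [] []) [true]
    refine congrArg (fun S => (⟨none, (none, none), S⟩ :
      TM2.Cfg (Alph I) (Lab p ⊕ Ctl I) (Mem I))) (Eq.trans ?_ h₂)
    refine congrArg (fun S : ∀ k, List (Alph I k) => Function.update S .out (true :: S .out))
      (Eq.trans ?_ h₁'')
    refine congrArg (fun S : ∀ k, List (Alph I k) =>
      Function.update S (.reg .A) (S (.reg .A)).tail) (Eq.trans ?_ h₁')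
    exact congrArg (fun S : ∀ k, List (Alph I k) =>
      Function.update S (.reg .A) (S (.reg .A)).tail) h₁

/-- The machine that decides a language by running `p` on the code of the reversed input word. -/
noncomputable def machine (I : Type) [Finite I] [Enc I] (p : Prog) : FinTM2 :=
  have := Lab.finite p
  letI := Fintype.ofFinite (Lab p ⊕ Ctl I)
  letI := Fintype.ofFinite (Mem I)
  letI : Fintype (Alph I .inp) := Fintype.ofFinite I
  { K := Stk
    k₀ := .inp
    k₁ := .out
    Γ := Alph I
    Λ := Lab p ⊕ Ctl I
    main := .inr none
    σ := Mem I
    initialState := (none, none)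
    m := program p }

theorem initList_machine [Finite I] [Enc I] (p : Prog) (w : List I) :
    initList (machine I p) w = ⟨some (.inr none), (none, none), contents w [] (mk [] [] [] [])⟩ := by
  refine congrArg (fun S => (⟨some (.inr none), (none, none), S⟩ :
      TM2.Cfg (Alph I) (Lab p ⊕ Ctl I) (Mem I))) ?_
  funext k
  rcases k with _ | _ | (_ | _ | _ | _) <;> rfl

theorem haltList_machine [Finite I] [Enc I] (p : Prog) (w : List Bool) :
    haltList (machine I p) w = ⟨none, (none, none), contents [] w (mk [] [] [] [])⟩ := by
  refine congrArg (fun S => (⟨none, (none, none), S⟩ :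
      TM2.Cfg (Alph I) (Lab p ⊕ Ctl I) (Mem I))) ?_
  funext k
  rcases k with _ | _ | (_ | _ | _ | _) <;> rfl

/-- Over a finite alphabet the codes of the symbols have bounded size. -/
theorem size_le_mul_length [Finite I] [Enc I] :
    ∃ c, ∀ w : List I, size w ≤ c * w.length + 1 := by
  have := Fintype.ofFinite I
  refine ⟨(∑ g : I, size g) + 1, fun w => ?_⟩
  induction w with
  | nil => simp [size_nil]
  | cons g w ih =>
    have := Finset.single_le_sum (f := fun g : I => size g) (fun _ _ => Nat.zero_le _)
      (Finset.mem_univ g)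
    rw [size_cons, List.length_cons, Nat.mul_add]
    omega

open Classical in
open Polynomial in
/-- A language is in P if its characteristic function is computed in polynomial time on codes. -/
theorem inP_of_PT [Finite I] [Enc I] {L : Language I} {f : List I → Bool} (hf : PT f)
    (h : ∀ w, f w = true ↔ w ∈ L) : CQA.InP L := by
  -- This compensates for the reversal caused by reading the input.
  have hf' : PT fun w : List I => f w.reverse := hf.comp (.reverse .id)
  obtain ⟨p, P, hp⟩ := hf'
  obtain ⟨c, hc⟩ := size_le_mul_length (I := I)
  refine ⟨{ tm := machine I p, inputAlphabet := Equiv.refl _, outputAlphabet := Equiv.refl _,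
            time := 2 * X + 3 + P.comp (C c * X + 1), outputsFun := fun w => ?_ }⟩
  -- One step to start, `2 * n + 1` to read a word of length `n`, the run of `p` on a code of size
  -- at most `c * n + 1`, and one step to answer.
  have key : ∃ n ≤ (2 * X + 3 + P.comp (C c * X + 1)).eval w.length,
      Steps (program p) ⟨some (.inr none), (none, none), contents w [] (mk [] [] [] [])⟩ n
      ⟨none, (none, none), contents [] [decide (w ∈ L)] (mk [] [] [] [])⟩ := by
    have h₁ : Steps (program p) ⟨some (.inr none), (none, none), contents w [] (mk [] [] [] [])⟩ 1
        ⟨some (.inr (some (some none))), (none, none),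
          contents w [] (mk (Enc.enc ([] : List I)).toks [] [] [])⟩ := by
      refine Steps.one ?_
      have h := update_contents_reg w [] (mk [] [] [] []) .A [.leaf]
      rw [update_mk_A] at h
      exact congrArg (fun S => (⟨some (.inr (some (some none))), (none, none), S⟩ :
        TM2.Cfg (Alph I) (Lab p ⊕ Ctl I) (Mem I))) h
    obtain ⟨v₁, h₂⟩ := steps_read p w [] (none, none)
    rw [List.append_nil] at h₂
    obtain ⟨t, ht, he⟩ := (hp w.reverse).2 [] [] [] []
    simp only [List.reverse_reverse, List.append_nil] at he
    obtain ⟨v₂, h₃⟩ := he.steps (M := program p) .inl (.inr (some none)) (fun _ => rfl) [] [] v₁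
    have h₄ := steps_write p (f w) v₂
    rw [show f w = decide (w ∈ L) by rw [Bool.eq_iff_iff, h w, decide_eq_true_iff]] at h₃ h₄
    refine ⟨_, ?_, h₁.trans (h₂.trans (h₃.trans h₄))⟩
    have h₅ := hc w.reverse
    rw [List.length_reverse] at h₅
    have h₆ := eval_mono P h₅
    have h₇ : t ≤ P.eval (size w.reverse) := ht
    simp only [eval_add, eval_mul, eval_comp, eval_X, eval_C, eval_one, eval_ofNat]
    omega
  choose n hn hs using key
  refine ⟨⟨n, ?_⟩, hn⟩
  have hw : List.map (Equiv.refl I).invFun w = w := by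
    simp
  have hb : List.map (Equiv.refl Bool).invFun (Computability.encodeBool (decide (w ∈ L))) =
      [decide (w ∈ L)] := rfl
  have h₁ := (congrArg (initList (machine I p)) hw).trans (initList_machine p w)
  have h₂ := (congrArg (haltList (machine I p)) hb).trans (haltList_machine p _)
  have hs' : (flip bind (TM2.step (program p)))^[n]
      (some ⟨some (.inr none), (none, none), contents w [] (mk [] [] [] [])⟩) =
      some ⟨none, (none, none), contents [] [decide (w ∈ L)] (mk [] [] [] [])⟩ := hs
  refine Eq.trans ?_ (hs'.trans (congrArg some h₂.symm))
  exact congrArg (fun c => (flip bind (TM2.step (program p)))^[n] (some c)) h₁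

end TreeMachine

/-! ### Edge choices that avoid a set of cycles. -/

namespace CQA

open Relation

/-! ### Choosing one outgoing edge at every vertex -/

section

variable {V : Type} {E : V → V → Prop} {C : List V → Prop} {k : ℕ}

/-- The iterates of `g` at `u` form a cycle of length `k` in `E` that belongs to `C`. -/
def FormsCycle (E : V → V → Prop) (C : List V → Prop) (k : ℕ) (g : V → V) (u : V) : Prop :=
  (∀ j < k, E (g^[j] u) (g^[j + 1] u)) ∧ g^[k] u = u ∧ C (List.iterate g u k)

/-- On `U`, the function `g` chooses an edge into `U` at every vertex that has outgoing edges, in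
such a way that no cycle of `C` is chosen. -/
structure Region (E : V → V → Prop) (C : List V → Prop) (k : ℕ) (U : Set V) (g : V → V) : Prop where
  step : ∀ u ∈ U, (∃ w, E u w) → E u (g u) ∧ g u ∈ U
  free : ∀ u ∈ U, ¬ FormsCycle E C k g u

/-- The vertex `x` belongs to some region. -/
def Good (E : V → V → Prop) (C : List V → Prop) (k : ℕ) (x : V) : Prop :=
  ∃ U g, Region E C k U g ∧ x ∈ U

theorem iterate_eq_of_agree {g h : V → V} {u : V} {n : ℕ}
    (H : ∀ j < n, g (h^[j] u) = h (h^[j] u)) : ∀ j ≤ n, g^[j] u = h^[j] u := by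
  intro j hj
  induction j with
  | zero => rfl
  | succ j ih =>
    rw [Function.iterate_succ_apply', Function.iterate_succ_apply', ih (by omega), H j (by omega)]

theorem list_iterate_congr {g h : V → V} {u : V} {n : ℕ} (H : ∀ j ≤ n, g^[j] u = h^[j] u) :
    List.iterate g u n = List.iterate h u n := by
  refine List.ext_getElem (by simp) fun i h₁ h₂ => ?_
  rw [List.length_iterate] at h₁
  simpa using H i (by omega)

theorem FormsCycle.congr {g h : V → V} {u : V} (H : ∀ j ≤ k, g^[j] u = h^[j] u)
    (hg : FormsCycle E C k g u) : FormsCycle E C k h u := by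
  refine ⟨fun j hj => ?_, ?_, ?_⟩
  · rw [← H j (by omega), ← H (j + 1) (by omega)]
    exact hg.1 j hj
  · rw [← H k le_rfl]
    exact hg.2.1
  · rw [← list_iterate_congr H]
    exact hg.2.2

open Classical in
/-- A region can be enlarged. -/
theorem Region.extend {U W : Set V} {g h : V → V} (hU : Region E C k U g)
    (hW : ∀ x ∈ W, (∃ w, E x w) → E x (h x) ∧ h x ∈ U ∪ W)
    (hfree : ∀ u, (∀ j ≤ k, h^[j] u ∈ W \ U) → ¬ FormsCycle E C k h u) :
    Region E C k (U ∪ W) (fun x => if x ∈ U then g x else h x) := by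
  set f : V → V := fun x => if x ∈ U then g x else h x with hf
  have hfU : ∀ x ∈ U, f x = g x := fun x hx => if_pos hx
  have hfW : ∀ x ∉ U, f x = h x := fun x hx => if_neg hx
  have hstep : ∀ u ∈ U ∪ W, (∃ w, E u w) → E u (f u) ∧ f u ∈ U ∪ W := by
    intro u hu hw
    by_cases h₁ : u ∈ U
    · rw [hfU u h₁]
      exact ⟨(hU.step u h₁ hw).1, Or.inl (hU.step u h₁ hw).2⟩
    · rw [hfW u h₁]
      exact hW u (hu.resolve_left h₁) hw
  refine ⟨hstep, fun u hu hc => ?_⟩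
  have hmem : ∀ j ≤ k, f^[j] u ∈ U ∪ W := by
    intro j hj
    induction j with
    | zero => exact hu
    | succ j ih =>
      rw [Function.iterate_succ_apply']
      exact (hstep _ (ih (by omega)) ⟨_, hc.1 j (by omega)⟩).2
  -- `U` is closed under the choice, so a cycle that meets `U` lies in `U` and is one of `g`; any
  -- other cycle lies in `W \ U` and is one of `h`.
  have hstay : ∀ i ≤ k, f^[i] u ∈ U → ∀ j, i ≤ j → j ≤ k → f^[j] u ∈ U := by
    intro i hi hiU j hij hj
    induction j, hij using Nat.le_induction with
    | base => exact hiU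
    | succ j hij ih =>
      have := ih (by omega)
      rw [Function.iterate_succ_apply', hfU _ this]
      exact (hU.step _ this ⟨_, hc.1 j (by omega)⟩).2
  by_cases h₁ : ∃ i ≤ k, f^[i] u ∈ U
  · obtain ⟨i, hi, hiU⟩ := h₁
    have hkU := hstay i hi hiU k hi le_rfl
    rw [hc.2.1] at hkU
    have hall := hstay 0 (Nat.zero_le _) hkU
    refine hU.free u hkU (hc.congr fun j hj => ?_)
    exact (iterate_eq_of_agree (n := k)
      (fun j hj => (hfU _ (hall j (Nat.zero_le _) (by omega))).symm) j hj).symm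
  · push Not at h₁
    have heq : ∀ j ≤ k, f^[j] u = h^[j] u := fun j hj =>
      (iterate_eq_of_agree (n := k) (fun j hj => (hfW _ (h₁ j (by omega))).symm) j hj).symm
    refine hfree u (fun j hj => ?_) (hc.congr heq)
    rw [← heq j hj]
    exact ⟨(hmem j hj).resolve_left (h₁ j hj), h₁ j hj⟩

theorem region_empty (g : V → V) : Region E C k ∅ g := ⟨by simp, by simp⟩

/-- Add `x` with the edge to `y`. A new cycle would have to avoid the old region, but its first step
enters that region at `y`. -/
theorem Good.of_edge (hk : 1 ≤ k) {x y : V} (hxy : E x y) (hy : Good E C k y) : Good E C k x := by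
  obtain ⟨U, g, hU, hyU⟩ := hy
  refine ⟨U ∪ {x}, _, hU.extend (W := {x}) (h := fun _ => y) ?_ ?_, Or.inr rfl⟩
  · rintro _ rfl _
    exact ⟨hxy, Or.inl hyU⟩
  · intro u hu _
    exact (hu 1 hk).2 hyU

theorem Good.of_reach (hk : 1 ≤ k) {x y : V} (hxy : ReflTransGen E x y) (hy : Good E C k y) :
    Good E C k x := by
  induction hxy using ReflTransGen.head_induction_on with
  | refl => exact hy
  | head h _ ih => exact Good.of_edge hk h ih

/-- A sink requires no choice, and a cycle through it would need an outgoing edge. -/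
theorem Good.of_dead (hk : 1 ≤ k) {x : V} (hx : ¬ ∃ w, E x w) : Good E C k x := by
  refine ⟨{x}, id, ⟨?_, ?_⟩, rfl⟩
  · rintro _ rfl h
    exact absurd h hx
  · rintro _ rfl h
    exact hx ⟨_, h.1 0 hk⟩

/-- If every vertex belongs to some region, there is a region that contains all vertices. -/
theorem exists_region_univ (hk : 1 ≤ k) (s : Finset V) (hs : ∀ x y, E x y → x ∈ s)
    (h : ∀ x ∈ s, Good E C k x) : ∃ g, Region E C k Set.univ g := by
  classical
  have key : ∀ t : Finset V, t ⊆ s → ∃ U g, Region E C k U g ∧ ∀ x ∈ t, x ∈ U := by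
    intro t
    induction t using Finset.induction_on with
    | empty => exact fun _ => ⟨∅, id, region_empty _, by simp⟩
    | insert x t _ ih =>
      intro ht
      obtain ⟨U, g, hU, htU⟩ := ih ((Finset.subset_insert _ _).trans ht)
      obtain ⟨W, g', hW, hxW⟩ := h x (ht (Finset.mem_insert_self _ _))
      refine ⟨U ∪ W, _, hU.extend (W := W) (h := g') ?_ ?_, ?_⟩
      · exact fun x hx hw => ⟨(hW.step x hx hw).1, Or.inr (hW.step x hx hw).2⟩
      · exact fun u hu => hW.free u (hu 0 (Nat.zero_le _)).1
      · intro y hy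
        rcases Finset.mem_insert.1 hy with rfl | hy
        · exact Or.inr hxW
        · exact Or.inl (htU y hy)
  obtain ⟨U, g, hU, hsU⟩ := key s subset_rfl
  -- Vertices outside `s` have no outgoing edges, so they impose no condition on `g`.
  exact ⟨g, fun u _ hw => ⟨(hU.step u (hsU u (hs _ _ hw.choose_spec)) hw).1, Set.mem_univ _⟩,
    fun u _ hc => hU.free u (hsU u (hs _ _ (hc.1 0 hk))) hc⟩

/-! ### Cycles that avoid `C` -/

/-- There is an elementary cycle through `x` that does not belong to `C`: a path of `k` edges
leads from `x` to `b`, and unless this is a cycle of `C`, one can return from `b` to `x` without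
meeting the inner vertices of the path. -/
def OnGoodCycle (E : V → V → Prop) (C : List V → Prop) (k : ℕ) (x : V) : Prop :=
  ∃ (mid : List V) (b : V), mid.length + 1 = k ∧ List.IsChain E (x :: mid ++ [b]) ∧
    ¬ (b = x ∧ C (x :: mid)) ∧ ReflTransGen (fun y z => E y z ∧ z ∉ mid) b x

/-- The rank is the distance to `a`, and the first step of a shortest walk lowers it. A choice that
follows decreasing rank must end at `a`. -/
theorem exists_rank {r : V → V → Prop} (a : V) : ∃ rank : V → ℕ, ∀ x, ReflTransGen r x a →
    x ≠ a → ∃ y, r x y ∧ ReflTransGen r y a ∧ rank y < rank x := by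
  -- `D n x` says that some `r`-walk of exactly `n` steps leads from `x` to `a`.
  let D : ℕ → V → Prop := fun n => n.rec (fun x => x = a) (fun _ P x => ∃ y, r x y ∧ P y)
  have hD : ∀ x, ReflTransGen r x a → ∃ n, D n x := by
    intro x hx
    induction hx using ReflTransGen.head_induction_on with
    | refl => exact ⟨0, rfl⟩
    | head h _ ih =>
      obtain ⟨n, hn⟩ := ih
      exact ⟨n + 1, _, h, hn⟩
  have hD' : ∀ n x, D n x → ReflTransGen r x a := by
    intro n
    induction n with
    | zero =>
      intro x hx
      rw [show x = a from hx]
    | succ n ih =>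
      rintro x ⟨y, hxy, hy⟩
      exact .head hxy (ih y hy)
  refine ⟨fun x => sInf {n | D n x}, fun x hx hne => ?_⟩
  have hmem : D (sInf {n | D n x}) x := Nat.sInf_mem (s := {n | D n x}) (hD x hx)
  rcases hn : sInf {n | D n x} with _ | n
  · rw [hn] at hmem
    exact absurd hmem hne
  · rw [hn] at hmem
    obtain ⟨y, hxy, hy⟩ := hmem
    refine ⟨y, hxy, hD' n y hy, ?_⟩
    show sInf {n | D n y} < sInf {n | D n x}
    rw [hn]
    exact Nat.lt_succ_of_le (Nat.sInf_le hy)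

/-- The vertices have types `0, …, k - 1`, and edges lead from each type to the next one. -/
structure Typing (E : V → V → Prop) (k : ℕ) (τ : V → ℕ) : Prop where
  lt : ∀ x, τ x < k
  step : ∀ x y, E x y → τ y = (τ x + 1) % k

theorem Typing.iterate {τ : V → ℕ} (hτ : Typing E k τ) {g : V → V} {u : V} {n : ℕ}
    (h : ∀ j < n, E (g^[j] u) (g^[j + 1] u)) : ∀ j ≤ n, τ (g^[j] u) = (τ u + j) % k := by
  intro j hj
  induction j with
  | zero => exact (Nat.mod_eq_of_lt (hτ.lt u)).symm
  | succ j ih =>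
    rw [hτ.step _ _ (h j (by omega)), ih (by omega), Nat.mod_add_mod, Nat.add_assoc]

/-- Choose the path from `x` to `b`, and at all other vertices that can return to `x` a step of
smaller rank. Every orbit in the resulting set passes through `x`, so the only cycle chosen is the
given one. Types separate the inner vertices of the path, which have nonzero type, from `x` and `b`,
which have type `0`. -/
theorem Good.of_onGoodCycle {τ : V → ℕ} (hτ : Typing E k τ) (hC : ∀ x l, C (x :: l) → τ x = 0)
    {x : V} (hx : τ x = 0) (h : OnGoodCycle E C k x) : Good E C k x := by
  classical
  obtain ⟨mid, b, hlen, hchain, hgood, hback⟩ := h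
  set r : V → V → Prop := fun y z => E y z ∧ z ∉ mid with hr
  obtain ⟨rank, hrank⟩ := exists_rank (r := r) x
  set L : List V := x :: mid ++ [b] with hL
  have hLlen : L.length = k + 1 := by simp [hL]; omega
  let p : ℕ → V := fun j => L.getD j x
  have hpE : ∀ j < k, E (p j) (p (j + 1)) := by
    intro j hj
    have := List.isChain_iff_getElem.1 hchain j (by omega)
    simp only [p, List.getD_eq_getElem?_getD]
    rw [List.getElem?_eq_getElem (by omega), List.getElem?_eq_getElem (by omega)]
    exact this
  have hp0 : p 0 = x := rfl
  have hpk : p k = b := by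
    simp only [p, hL, List.getD_eq_getElem?_getD]
    rw [List.getElem?_append_right (by simp; omega)]
    simp [hlen]
  have hpmid : ∀ y, y ∈ mid ↔ ∃ j, 1 ≤ j ∧ j < k ∧ p j = y := by
    intro y
    have : ∀ j, j + 1 < k → p (j + 1) = mid.getD j x := by
      intro j hj
      simp only [p, hL, List.getD_eq_getElem?_getD, List.cons_append, List.getElem?_cons_succ]
      rw [List.getElem?_append_left (by omega)]
    constructor
    · intro hy
      obtain ⟨j, hj, rfl⟩ := List.getElem_of_mem hy
      refine ⟨j + 1, by omega, by omega, ?_⟩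
      rw [this j (by omega), List.getD_eq_getElem _ _ hj]
    · rintro ⟨j, h₁, h₂, rfl⟩
      obtain ⟨j, rfl⟩ : ∃ i, j = i + 1 := ⟨j - 1, by omega⟩
      rw [this j h₂, List.getD_eq_getElem _ _ (by omega)]
      exact List.getElem_mem _
  have hpτ : ∀ j ≤ k, τ (p j) = j % k := by
    intro j hj
    induction j with
    | zero => rw [hp0, hx, Nat.zero_mod]
    | succ j ih => rw [hτ.step _ _ (hpE j (by omega)), ih (by omega), Nat.mod_add_mod]
  have hmidτ : ∀ y ∈ mid, τ y ≠ 0 := by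
    intro y hy
    obtain ⟨j, h₁, h₂, rfl⟩ := (hpmid y).1 hy
    rw [hpτ j h₂.le, Nat.mod_eq_of_lt h₂]
    omega
  have hb : b ∉ mid := fun h => hmidτ b h (by rw [← hpk, hpτ k le_rfl, Nat.mod_self])
  have hxmid : x ∉ mid := fun h => hmidτ x h hx
  -- For `j < k` the vertex `p j` has type `j`, so the first test asks whether `y` is one of `p 0,
  -- …, p (k - 1)`. The final `else` is an arbitrary default.
  let g : V → V := fun y => if y = p (τ y) then p (τ y + 1) else
    if h : ReflTransGen r y x ∧ y ≠ x then (hrank y h.1 h.2).choose else y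
  have hgp : ∀ j < k, g (p j) = p (j + 1) := by
    intro j hj
    have : τ (p j) = j := by rw [hpτ j hj.le, Nat.mod_eq_of_lt hj]
    simp only [g, this, if_true]
  have hgd : ∀ y, y ∉ mid → ReflTransGen r y x → y ≠ x →
      r y (g y) ∧ ReflTransGen r (g y) x ∧ rank (g y) < rank y := by
    intro y hy hyx hne
    have hne' : y ≠ p (τ y) := by
      intro h
      rcases Nat.eq_zero_or_pos (τ y) with h₀ | h₀
      · rw [h₀, hp0] at h; exact hne h
      · exact hy ((hpmid y).2 ⟨τ y, h₀, hτ.lt y, h.symm⟩)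
    simp only [g, if_neg hne', dif_pos (show ReflTransGen r y x ∧ y ≠ x from ⟨hyx, hne⟩)]
    exact (hrank y hyx hne).choose_spec
  have hgiter : ∀ j ≤ k, g^[j] x = p j := by
    intro j hj
    induction j with
    | zero => rfl
    | succ j ih => rw [Function.iterate_succ_apply', ih (by omega), hgp j (by omega)]
  -- every vertex outside the path from which `x` can be reached is led to `x`
  have hhit : ∀ n y, rank y = n → y ∉ mid → ReflTransGen r y x → ∃ j, g^[j] y = x := by
    intro n
    induction n using Nat.strong_induction_on with
    | _ n ih =>
      intro y hn hy hyx
      by_cases hne : y = x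
      · exact ⟨0, hne⟩
      · obtain ⟨h₁, h₂, h₃⟩ := hgd y hy hyx hne
        obtain ⟨j, hj⟩ := ih _ (hn ▸ h₃) (g y) rfl h₁.2 h₂
        exact ⟨j + 1, by rwa [Function.iterate_succ_apply]⟩
  let U : Set V := {y | y ∈ mid ∨ ReflTransGen r y x}
  have hhitU : ∀ y ∈ U, ∃ j, g^[j] y = x := by
    intro y hy
    by_cases hm : y ∈ mid
    · obtain ⟨i, h₁, h₂, rfl⟩ := (hpmid y).1 hm
      obtain ⟨j, hj⟩ := hhit _ b rfl hb hback
      refine ⟨j + (k - i), ?_⟩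
      have : g^[k - i] (p i) = b := by
        rw [← hgiter i h₂.le, ← Function.iterate_add_apply, Nat.sub_add_cancel h₂.le,
          hgiter k le_rfl, hpk]
      rw [Function.iterate_add_apply, this, hj]
    · exact hhit _ y rfl hm (hy.resolve_left hm)
  have hpath : ∀ j < k, E (p j) (g (p j)) ∧ g (p j) ∈ U := by
    intro j hj
    rw [hgp j hj]
    refine ⟨hpE j hj, ?_⟩
    by_cases hjk : j + 1 < k
    · exact Or.inl ((hpmid _).2 ⟨j + 1, by omega, hjk, rfl⟩)
    · rw [show j + 1 = k by omega, hpk]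
      exact Or.inr hback
  refine ⟨U, g, ⟨fun u hu _ => ?_, fun u hu hc => ?_⟩, Or.inr .refl⟩
  · by_cases hm : u ∈ mid
    · obtain ⟨i, h₁, h₂, rfl⟩ := (hpmid u).1 hm
      exact hpath i h₂
    · by_cases hne : u = x
      · rw [hne, ← hp0]
        exact hpath 0 (by omega)
      · obtain ⟨h₁, h₂, _⟩ := hgd u hm (hu.resolve_left hm) hne
        exact ⟨h₁.1, Or.inr h₂⟩
  -- A chosen cycle of `C` at `u` passes through `x`, so `x` has period `k` and `b = x`. Both `u`
  -- and `x` have type `0`, which forces `u = x`; the cycle is then `x :: mid`, excluded by `hgood`.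
  · obtain ⟨j, hj⟩ := hhitU u hu
    have hper : Function.IsPeriodicPt g k u := hc.2.1
    have hgx : g^[k] x = x := by
      rw [← hj, ← Function.iterate_add_apply, Nat.add_comm, Function.iterate_add_apply, hc.2.1]
    have hbx : b = x := by rw [← hpk, ← hgiter k le_rfl, hgx]
    have hk : 0 < k := by omega
    have huτ : τ u = 0 := by
      have h := hc.2.2
      obtain ⟨k', rfl⟩ : ∃ k', k = k' + 1 := ⟨k - 1, by omega⟩
      rw [List.iterate] at h
      exact hC _ _ h
    have hj' : g^[j % k] u = x := by
      rw [← hj]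
      exact hper.iterate_mod_apply j
    have hux : u = x := by
      have h := hτ.iterate hc.1 (j % k) (Nat.mod_lt _ hk).le
      rw [hj', hx, huτ, Nat.zero_add, Nat.mod_mod] at h
      rw [← h] at hj'
      exact hj'
    refine hgood ⟨hbx, ?_⟩
    have h := hc.2.2
    rw [hux] at h
    convert h using 1
    refine List.ext_getElem (by simp [hlen]) fun i h₁ h₂ => ?_
    rw [List.length_iterate] at h₂
    rw [List.getElem_iterate, hgiter i h₂.le]
    simp only [p, hL, List.getD_eq_getElem?_getD]
    rw [List.getElem?_append_left h₁, List.getElem?_eq_getElem h₁]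
    rfl

/-- The orbit of `v` under the region's choice never stops and stays in a finite set, so it runs
into a cycle. That cycle is chosen, hence not in `C`. -/
theorem Good.exists_reach {τ : V → ℕ} (hτ : Typing E k τ) (s : Finset V)
    (hs : ∀ x y, E x y → x ∈ s) {v : V} (hv : Good E C k v)
    (hdead : ∀ w, ReflTransGen E v w → ∃ y, E w y) :
    ∃ x, ReflTransGen E v x ∧ τ x = 0 ∧ OnGoodCycle E C k x := by
  obtain ⟨U, g, hU, hvU⟩ := hv
  have horbit : ∀ n, ReflTransGen E v (g^[n] v) ∧ g^[n] v ∈ U := by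
    intro n
    induction n with
    | zero => exact ⟨.refl, hvU⟩
    | succ n ih =>
      have := hU.step _ ih.2 (hdead _ ih.1)
      rw [Function.iterate_succ_apply']
      exact ⟨ih.1.tail this.1, this.2⟩
  have hE : ∀ n, E (g^[n] v) (g^[n + 1] v) := fun n => by
    rw [Function.iterate_succ_apply']
    exact (hU.step _ (horbit n).2 (hdead _ (horbit n).1)).1
  have hk : 0 < k := (Nat.zero_le _).trans_lt (hτ.lt v)
  obtain ⟨m, n, hmn, heq⟩ := Finite.exists_ne_map_eq_of_infinite
    (fun n : ℕ => (⟨g^[n] v, hs _ _ (hE n)⟩ : s))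
  wlog hlt : m < n generalizing m n
  · exact this n m hmn.symm heq.symm (by omega)
  have heq : g^[m] v = g^[n] v := congrArg Subtype.val heq
  have hper₀ : Function.IsPeriodicPt g (n - m) (g^[m] v) := by
    show g^[n - m] (g^[m] v) = g^[m] v
    rw [← Function.iterate_add_apply, Nat.sub_add_cancel hlt.le, heq]
  -- From the repeated vertex, advance to the next vertex of type `0` on the same cycle.
  set t := k - τ (g^[m] v) + m with ht
  set x := g^[t] v with hx
  have hxE : ∀ j, E (g^[j] x) (g^[j + 1] x) := fun j => by
    rw [hx, ← Function.iterate_add_apply, ← Function.iterate_add_apply,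
      show j + 1 + t = (j + t) + 1 by omega]
    exact hE _
  have hxU : ∀ j, g^[j] x ∈ U := fun j => by
    rw [hx, ← Function.iterate_add_apply]
    exact (horbit _).2
  have hxτ : τ x = 0 := by
    have h := hτ.iterate (g := g) (u := g^[m] v) (n := k - τ (g^[m] v)) (fun j _ => by
      rw [← Function.iterate_add_apply, ← Function.iterate_add_apply,
        show j + 1 + m = (j + m) + 1 by omega]
      exact hE _) _ le_rfl
    rw [← Function.iterate_add_apply, Nat.add_sub_cancel' (hτ.lt _).le, Nat.mod_self] at h
    exact h
  have hper : Function.IsPeriodicPt g (n - m) x := by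
    rw [hx, ht, Function.iterate_add_apply]
    exact hper₀.apply_iterate _
  set q := Function.minimalPeriod g x with hq
  have hq0 : 0 < q := hper.minimalPeriod_pos (by omega)
  have hqx : g^[q] x = x := Function.iterate_minimalPeriod
  -- The type is restored after `q` steps, so `k` divides the minimal period `q`.
  have hkq : k ≤ q := by
    have h := hτ.iterate (g := g) (u := x) (n := q) (fun j _ => hxE j) q le_rfl
    rw [hqx, hxτ, Nat.zero_add] at h
    exact Nat.le_of_dvd hq0 (Nat.dvd_of_mod_eq_zero h.symm)
  have hmid : ∀ y, y ∈ List.iterate g (g x) (k - 1) → ∃ i, 1 ≤ i ∧ i < k ∧ g^[i] x = y := by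
    intro y hy
    obtain ⟨i, hi, rfl⟩ := List.getElem_of_mem hy
    rw [List.length_iterate] at hi
    exact ⟨i + 1, by omega, by omega, by rw [List.getElem_iterate, Function.iterate_succ_apply]⟩
  have hcons : x :: List.iterate g (g x) (k - 1) = List.iterate g x k := by
    obtain ⟨k', rfl⟩ : ∃ k', k = k' + 1 := ⟨k - 1, by omega⟩
    rfl
  refine ⟨x, (horbit t).1, hxτ, List.iterate g (g x) (k - 1), g^[k] x, by simp; omega, ?_, ?_, ?_⟩
  · have : x :: List.iterate g (g x) (k - 1) ++ [g^[k] x] = List.iterate g x (k + 1) := by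
      rw [hcons, List.iterate_add]
      rfl
    rw [this, List.isChain_iff_getElem]
    intro i hi
    rw [List.getElem_iterate, List.getElem_iterate]
    exact hxE i
  · rintro ⟨h₁, h₂⟩
    rw [hcons] at h₂
    exact hU.free x (hxU 0) ⟨fun j _ => hxE j, h₁, h₂⟩
  -- Iterates below the minimal period are distinct, so the way back meets no inner vertex. The
  -- endpoint `j = q` is `x` itself, the iterate of index `0`.
  · have key : ∀ j, k ≤ j → j ≤ q → ReflTransGen
        (fun y z => E y z ∧ z ∉ List.iterate g (g x) (k - 1)) (g^[k] x) (g^[j] x) := by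
      intro j hkj hjq
      induction j, hkj using Nat.le_induction with
      | base => exact .refl
      | succ j hkj ih =>
        refine (ih (by omega)).tail ⟨hxE j, fun hm => ?_⟩
        obtain ⟨i, h₁, h₂, h₃⟩ := hmid _ hm
        rcases Nat.lt_or_eq_of_le hjq with h₄ | h₄
        · have := (Function.iterate_eq_iterate_iff_of_lt_minimalPeriod (by omega) h₄).1 h₃
          omega
        · rw [h₄, hqx] at h₃
          have := (Function.iterate_eq_iterate_iff_of_lt_minimalPeriod (m := i) (n := 0)
            (by omega) hq0).1 h₃
          omega
    have := key q hkq le_rfl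
    rwa [hqx] at this

/-- A choice of outgoing edges that avoids the cycles of `C` exists if and only if every vertex
reaches a vertex without outgoing edges or an elementary cycle that does not belong to `C`. -/
theorem exists_region_univ_iff {τ : V → ℕ} (hτ : Typing E k τ) (hk : 1 ≤ k)
    (hC : ∀ x l, C (x :: l) → τ x = 0) (s : Finset V) (hs : ∀ x y, E x y → x ∈ s) :
    (∃ g, Region E C k Set.univ g) ↔ ∀ v ∈ s, ∃ w, ReflTransGen E v w ∧
      ((¬ ∃ y, E w y) ∨ (τ w = 0 ∧ OnGoodCycle E C k w)) := by
  constructor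
  · rintro ⟨g, hg⟩ v _
    by_cases h : ∀ w, ReflTransGen E v w → ∃ y, E w y
    · obtain ⟨x, h₁, h₂⟩ := Good.exists_reach hτ s hs ⟨_, g, hg, Set.mem_univ v⟩ h
      exact ⟨x, h₁, Or.inr h₂⟩
    · push Not at h
      obtain ⟨w, h₁, h₂⟩ := h
      exact ⟨w, h₁, Or.inl (by simpa using h₂)⟩
  · intro h
    refine exists_region_univ hk s hs fun v hv => ?_
    obtain ⟨w, h₁, h₂ | ⟨h₂, h₃⟩⟩ := h v hv
    · exact Good.of_reach hk h₁ (Good.of_dead hk h₂)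
    · exact Good.of_reach hk h₁ (Good.of_onGoodCycle hτ hC h₂ h₃)

end

end CQA

/-! ### Falsifying repairs correspond to cycle-avoiding edge choices. -/

namespace CQA

open Relation

/-! ### Certainty of `ACq_k` in terms of regions -/

/-- The vertices: constants at the positions `0, …, k - 1`. -/
abbrev Vertex (k : ℕ) : Type := Fin k × Const

/-- Relation names with lists of arguments. -/
abbrev RawFact (k : ℕ) : Type := ACqRel k × List Const

section

variable {k : ℕ}

/-- The edges given by the facts `R_i(a, b)`. -/
def Edge (F : Set (RawFact k)) (u w : Vertex k) : Prop :=
  (ACqRel.R u.1, [u.2, w.2]) ∈ F ∧ w.1 = cyclicSucc u.1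

/-- The cycles given by the facts `S(a₁, …, a_k)`. -/
def MarkedCycle (F : Set (RawFact k)) (l : List (Vertex k)) : Prop :=
  (ACqRel.S, l.map Prod.snd) ∈ F ∧ ∀ x ∈ l.head?, x.1.val = 0

theorem Edge.typing (F : Set (RawFact k)) : Typing (Edge F) k (fun u => u.1.val) :=
  ⟨fun u => u.1.isLt, fun u w h => by rw [h.2]; rfl⟩

theorem MarkedCycle.head_eq (F : Set (RawFact k)) (x : Vertex k) (l : List (Vertex k))
    (h : MarkedCycle F (x :: l)) : x.1.val = 0 := h.2 x rfl

end

theorem Atom.ext_args {σ : Schema} {T : Type} {A B : Atom σ T} (h₁ : A.rel = B.rel)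
    (h₂ : A.args = B.args) : A = B := by
  obtain ⟨r, a, ha⟩ := A
  obtain ⟨s, b, hb⟩ := B
  simp only at h₁ h₂
  subst h₁ h₂
  rfl

theorem KeyEqual.symm {σ : Schema} {A B : Fact σ} (h : KeyEqual A B) : KeyEqual B A :=
  ⟨h.1.symm, h.2.symm⟩

/-- By maximality: a fact with no key-equal partner in the repair could be added to it. -/
theorem IsRepair.exists_keyEqual {σ : Schema} {db rep : Database σ} (h : IsRepair db rep)
    {A : Fact σ} (hA : A ∈ db) : ∃ B ∈ rep, KeyEqual B A := by
  classical
  by_contra! hne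
  have hins : insert A rep ⊆ db ∧ Consistent (insert A rep) := by
    refine ⟨Finset.insert_subset hA h.prop.1, ?_⟩
    intro B hB C hC hBC
    rcases Finset.mem_insert.1 hB with hB | hB <;> rcases Finset.mem_insert.1 hC with hC | hC
    · exact hB.trans hC.symm
    · exact absurd (hB ▸ hBC.symm) (hne C hC)
    · exact absurd (hC ▸ hBC) (hne B hB)
    · exact h.prop.2 B hB C hC hBC
  have := h.le_of_ge hins (Finset.subset_insert _ _) (Finset.mem_insert_self A rep)
  exact hne A this ⟨rfl, rfl⟩

section

variable {k : ℕ} {hk : 2 ≤ k}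

/-- The raw facts of a database. -/
def rawFacts (db : Database (acqSchema k hk)) : Set (RawFact k) :=
  {p | ∃ A ∈ db, ((A.rel, A.args) : RawFact k) = p}

theorem key_of_S {A : Fact (acqSchema k hk)} (h : A.rel = ACqRel.S) : Fact.key A = A.args := by
  obtain ⟨r, a, ha⟩ := A
  simp only at h
  subst h
  exact List.take_of_length_le ha.le

theorem args_of_R {A : Fact (acqSchema k hk)} {i : Fin k} (h : A.rel = ACqRel.R i) :
    ∃ a b, A.args = [a, b] ∧ Fact.key A = [a] := by
  obtain ⟨r, a, ha⟩ := A
  simp only at h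
  subst h
  obtain ⟨x, y, rfl⟩ := List.length_eq_two.1 ha
  exact ⟨x, y, rfl, rfl⟩

/-- Facts of the all-key relation never conflict, so every repair retains all of them. -/
theorem eq_of_keyEqual_S {A B : Fact (acqSchema k hk)} (h : A.rel = ACqRel.S)
    (hAB : KeyEqual A B) : A = B := by
  refine Atom.ext_args hAB.1 ?_
  rw [← key_of_S h, ← key_of_S (hAB.1.symm.trans h)]
  exact hAB.2

theorem satisfies_acq_iff (db : Database (acqSchema k hk)) :
    Satisfies db (acq k hk) ↔ ∃ θ : Fin k → Const,
      (ACqRel.S, List.ofFn θ) ∈ rawFacts db ∧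
        ∀ i, (ACqRel.R i, [θ i, θ (cyclicSucc i)]) ∈ rawFacts db := by
  have hS : ∀ θ : Fin k → Const, (acqS k hk).subst θ ∈ db ↔
      (ACqRel.S, List.ofFn θ) ∈ rawFacts db := by
    intro θ
    have : ((acqS k hk).subst θ).args = List.ofFn θ := by
      simp [Atom.subst, acqS, List.map_ofFn, Function.comp_def]
    constructor
    · intro h
      exact ⟨_, h, by rw [this]; rfl⟩
    · rintro ⟨A, hA, h⟩
      replace h := Prod.mk.inj h
      rwa [Atom.ext_args (A := (acqS k hk).subst θ) (B := A) h.1.symm (this.trans h.2.symm)]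
  have hR : ∀ (θ : Fin k → Const) i, (acqR k hk i).subst θ ∈ db ↔
      (ACqRel.R i, [θ i, θ (cyclicSucc i)]) ∈ rawFacts db := by
    intro θ i
    constructor
    · intro h
      exact ⟨_, h, rfl⟩
    · rintro ⟨A, hA, h⟩
      replace h := Prod.mk.inj h
      rwa [Atom.ext_args (A := (acqR k hk i).subst θ) (B := A) h.1.symm h.2.symm]
  unfold Satisfies acq
  refine exists_congr fun θ => ?_
  rw [← hS]
  simp only [← hR, Finset.mem_insert, Finset.mem_image, Finset.mem_univ, true_and,
    forall_eq_or_imp, forall_exists_index, forall_apply_eq_imp_iff]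

/-- Let `g` follow the `R`-facts kept by the repair, which meets every block. A marked cycle chosen
by `g` would be a valuation satisfying the query in the repair. -/
theorem region_of_repair {db rep : Database (acqSchema k hk)} (hrep : IsRepair db rep)
    (hsat : ¬ Satisfies rep (acq k hk)) :
    ∃ g, Region (Edge (rawFacts db)) (MarkedCycle (rawFacts db)) k Set.univ g := by
  classical
  have hedge : ∀ u, (∃ w, Edge (rawFacts db) u w) → ∃ w, Edge (rawFacts rep) u w := by
    rintro ⟨i, a⟩ ⟨⟨j, b⟩, ⟨A, hA, h⟩, hj⟩
    replace h := Prod.mk.inj h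
    obtain ⟨B, hB, hBA⟩ := hrep.exists_keyEqual hA
    obtain ⟨x, y, h₁, h₂⟩ := args_of_R (hBA.1.trans h.1)
    obtain ⟨x', y', h₁', h₂'⟩ := args_of_R h.1
    have hx : x = a := by
      have e₁ := hBA.2
      rw [h₂, h₂'] at e₁
      have e₂ := h₁'.symm.trans h.2
      simp only [List.cons.injEq, and_true] at e₁ e₂
      exact e₁.trans e₂.1
    exact ⟨(cyclicSucc i, y), ⟨B, hB, Prod.ext (hBA.1.trans h.1) (by rw [h₁, hx])⟩, rfl⟩
  have hsub : rawFacts rep ⊆ rawFacts db := by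
    rintro p ⟨A, hA, h⟩
    exact ⟨A, hrep.prop.1 hA, h⟩
  let g : Vertex k → Vertex k := fun u =>
    if h : ∃ w, Edge (rawFacts rep) u w then h.choose else u
  have hg : ∀ u, (∃ w, Edge (rawFacts db) u w) → Edge (rawFacts rep) u (g u) := by
    intro u hu
    have h := hedge u hu
    simp only [g, dif_pos h]
    exact h.choose_spec
  refine ⟨g, fun u _ hu => ⟨⟨hsub (hg u hu).1, (hg u hu).2⟩, trivial⟩, fun u _ hc => hsat ?_⟩
  rw [satisfies_acq_iff]
  -- A marked cycle starts at position `0`, so its `i`-th vertex has position `i` and its constants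
  -- match the arguments of `S` in order.
  have hu0 : u.1.val = 0 := by
    have h := hc.2.2
    obtain ⟨k', rfl⟩ : ∃ k', k = k' + 1 := ⟨k - 1, by omega⟩
    exact MarkedCycle.head_eq _ _ _ h
  have hτ : ∀ j ≤ k, (g^[j] u).1.val = j % k := by
    intro j hj
    have := (Edge.typing (rawFacts db)).iterate hc.1 j hj
    simpa [hu0] using this
  refine ⟨fun i => (g^[i.val] u).2, ?_, fun i => ?_⟩
  · obtain ⟨A, hA, h⟩ := hc.2.2.1
    replace h := Prod.mk.inj h
    obtain ⟨B, hB, hBA⟩ := hrep.exists_keyEqual hA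
    obtain rfl := eq_of_keyEqual_S (hBA.1.trans h.1) hBA
    refine ⟨B, hB, Prod.ext h.1 (h.2.trans ?_)⟩
    refine List.ext_getElem (by simp) fun j h₁ h₂ => ?_
    simp
  · have h := (hg _ ⟨_, hc.1 i.val i.isLt⟩).1
    rw [← Function.iterate_succ_apply' g] at h
    have h₁ : (g^[i.val] u).1 = i := Fin.ext (by rw [hτ i i.isLt.le, Nat.mod_eq_of_lt i.isLt])
    have h₂ : g^[(cyclicSucc i).val] u = g^[i.val + 1] u := by
      show g^[(i.val + 1) % k] u = _
      exact (show Function.IsPeriodicPt g k u from hc.2.1).iterate_mod_apply _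
    rw [h₁] at h
    show (ACqRel.R i, [(g^[i.val] u).2, (g^[(cyclicSucc i).val] u).2]) ∈ rawFacts rep
    rw [h₂]
    exact h

/-- Keep the `R`-facts that `g` selects, together with all `S`-facts. A satisfying valuation would
make `g` run through a marked cycle from position `0`. -/
theorem repair_of_region {db : Database (acqSchema k hk)} {g : Vertex k → Vertex k}
    (hg : Region (Edge (rawFacts db)) (MarkedCycle (rawFacts db)) k Set.univ g) :
    ∃ rep, IsRepair db rep ∧ ¬ Satisfies rep (acq k hk) := by
  classical
  let rep : Database (acqSchema k hk) := db.filter fun A => ∀ i a b, A.rel = ACqRel.R i →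
    A.args = [a, b] → g (i, a) = (cyclicSucc i, b)
  have hrep : ∀ A, A ∈ rep ↔ A ∈ db ∧ ∀ i a b, A.rel = ACqRel.R i →
    A.args = [a, b] → g (i, a) = (cyclicSucc i, b) := fun A => Finset.mem_filter
  refine ⟨rep, ⟨⟨fun A hA => ((hrep A).1 hA).1, ?_⟩, ?_⟩, ?_⟩
  · intro A hA B hB hAB
    rcases hr : A.rel with i | _
    · obtain ⟨a, b, h₁, h₂⟩ := args_of_R hr
      obtain ⟨a', b', h₁', h₂'⟩ := args_of_R (hAB.1.symm.trans hr)
      have e := hAB.2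
      rw [h₂, h₂'] at e
      simp only [List.cons.injEq, and_true] at e
      subst e
      have e₁ := ((hrep A).1 hA).2 _ _ _ hr h₁
      have e₂ := ((hrep B).1 hB).2 _ _ _ (hAB.1.symm.trans hr) h₁'
      have e₃ := e₁.symm.trans e₂
      simp only [Prod.mk.injEq, true_and] at e₃
      exact Atom.ext_args hAB.1 (by rw [h₁, h₁', e₃])
    · exact eq_of_keyEqual_S hr hAB
  -- Maximality: the block of an `R`-fact `A` of `t` already contains the fact selected by `g`, and
  -- consistency of `t` makes `A` equal to it.
  · rintro t ⟨htdb, htc⟩ hrt A hA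
    rcases hr : A.rel with i | _
    · obtain ⟨a, b, h₁, h₂⟩ := args_of_R hr
      have hE : Edge (rawFacts db) (i, a) (cyclicSucc i, b) :=
        ⟨⟨A, htdb hA, Prod.ext hr h₁⟩, rfl⟩
      have hstep := (hg.step (i, a) trivial ⟨_, hE⟩).1
      obtain ⟨⟨B, hB, hBe⟩, hg₁⟩ := hstep
      replace hBe := Prod.mk.inj hBe
      have hBrep : B ∈ rep := by
        refine (hrep B).2 ⟨hB, fun i' a' b' h₃ h₄ => ?_⟩
        have e₁ : i' = i := ACqRel.R.inj (h₃.symm.trans hBe.1)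
        have e₂ := h₄.symm.trans hBe.2
        simp only [List.cons.injEq, and_true] at e₂
        rw [e₁, e₂.1, e₂.2]
        exact Prod.ext hg₁ rfl
      have hAB : A = B := by
        refine htc A hA B (hrt hBrep) ⟨hr.trans hBe.1.symm, ?_⟩
        obtain ⟨a', b', h₁', h₂'⟩ := args_of_R hBe.1
        have e := h₁'.symm.trans hBe.2
        simp only [List.cons.injEq, and_true] at e
        rw [h₂, h₂', e.1]
      exact hAB ▸ hBrep
    · refine (hrep A).2 ⟨htdb hA, fun i a b h => ?_⟩
      have e := hr.symm.trans h
      exact absurd e (by simp)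
  · rw [satisfies_acq_iff]
    rintro ⟨θ, hS, hR⟩
    have hk0 : 0 < k := by omega
    have hstep : ∀ i, g (i, θ i) = (cyclicSucc i, θ (cyclicSucc i)) := by
      intro i
      obtain ⟨A, hA, h⟩ := hR i
      replace h := Prod.mk.inj h
      exact ((hrep A).1 hA).2 _ _ _ h.1 h.2
    have hdb : rawFacts rep ⊆ rawFacts db := by
      rintro p ⟨A, hA, h⟩
      exact ⟨A, ((hrep A).1 hA).1, h⟩
    have hiter : ∀ j, g^[j] (⟨0, hk0⟩, θ ⟨0, hk0⟩) =
        (⟨j % k, Nat.mod_lt _ hk0⟩, θ ⟨j % k, Nat.mod_lt _ hk0⟩) := by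
      intro j
      induction j with
      | zero => simp
      | succ j ih =>
        rw [Function.iterate_succ_apply', ih, hstep]
        have : cyclicSucc (⟨j % k, Nat.mod_lt _ hk0⟩ : Fin k) =
            ⟨(j + 1) % k, Nat.mod_lt _ hk0⟩ := Fin.ext (Nat.mod_add_mod j k 1)
        rw [this]
    refine hg.free (⟨0, hk0⟩, θ ⟨0, hk0⟩) trivial ⟨fun j _ => ?_, ?_, ?_, ?_⟩
    · rw [Function.iterate_succ_apply', hiter, hstep]
      exact ⟨hdb (hR _), rfl⟩
    · rw [hiter]
      simp
    · convert hdb hS using 2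
      refine List.ext_getElem (by simp) fun j h₁ h₂ => ?_
      have hj : j < k := by simpa using h₂
      simp [hiter, Nat.mod_eq_of_lt hj]
    · obtain ⟨k', rfl⟩ : ∃ k', k = k' + 1 := ⟨k - 1, by omega⟩
      simp [List.iterate]

theorem not_mem_certainty_iff (db : Database (acqSchema k hk)) :
    db ∉ certainty (acq k hk) ↔
      ∃ g, Region (Edge (rawFacts db)) (MarkedCycle (rawFacts db)) k Set.univ g := by
  constructor
  · intro h
    simp only [certainty, Set.mem_ofPred_eq, not_forall] at h
    obtain ⟨rep, hrep, hsat⟩ := h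
    exact region_of_repair hrep hsat
  · rintro ⟨g, hg⟩ h
    obtain ⟨rep, hrep, hsat⟩ := repair_of_region hg
    exact hsat (h rep hrep)

end

end CQA

/-! ### The decision procedure and its correctness. -/

namespace CQA

open Relation TreeMachine

/-! ### The decision procedure -/

section

variable {V : Type} [DecidableEq V]

/-- The vertices that are reachable from `b`. -/
def reachable (E : List (V × V)) (b : V) : List V :=
  E.foldl (fun R _ => (b :: E.map Prod.snd).filter fun w =>
    decide (w ∈ R) || E.any fun e => decide (e.1 ∈ R) && decide (e.2 = w)) [b]

/-- The paths with `n + 1` edges, as triples of the first vertex, the inner vertices, and the last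
vertex. -/
def paths (E : List (V × V)) : ℕ → List (V × List V × V)
  | 0 => E.map fun e => (e.1, [], e.2)
  | n + 1 => (paths E n).flatMap fun p =>
      (E.filter fun e => decide (e.2 = p.1)).map fun e => (e.1, p.1 :: p.2.1, p.2.2)

theorem mem_paths (E : List (V × V)) (n : ℕ) (x b : V) (mid : List V) :
    (x, mid, b) ∈ paths E n ↔
      mid.length = n ∧ List.IsChain (fun y z => (y, z) ∈ E) (x :: mid ++ [b]) := by
  induction n generalizing x mid with
  | zero =>
    simp only [paths, List.mem_map, Prod.mk.injEq, List.length_eq_zero_iff]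
    constructor
    · rintro ⟨e, he, rfl, rfl, rfl⟩
      exact ⟨rfl, by simpa using he⟩
    · rintro ⟨rfl, h⟩
      exact ⟨(x, b), by simpa using h, rfl, rfl, rfl⟩
  | succ n ih =>
    simp only [paths, List.mem_flatMap, List.mem_map, List.mem_filter, decide_eq_true_eq,
      Prod.mk.injEq, Prod.exists]
    constructor
    · rintro ⟨y, m, b', hp, x', y', ⟨he, rfl⟩, rfl, rfl, rfl⟩
      obtain ⟨h₁, h₂⟩ := (ih _ _).1 hp
      exact ⟨by simp [h₁], by simpa using ⟨he, by simpa using h₂⟩⟩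
    · rintro ⟨h₁, h₂⟩
      rcases mid with _ | ⟨y, m⟩
      · simp at h₁
      · simp only [List.cons_append, List.isChain_cons_cons] at h₂
        exact ⟨y, m, b, (ih _ _).2 ⟨by simpa using h₁, h₂.2⟩, x, y, ⟨h₂.1, rfl⟩, rfl, rfl, rfl⟩

/-- Apart from `b`, only targets of edges can be found, so `E.length` rounds of one-step expansion
are enough. -/
theorem mem_reachable (E : List (V × V)) (b u : V) :
    u ∈ reachable E b ↔ ReflTransGen (fun y z => (y, z) ∈ E) b u := by
  set f : List V → List V := fun R => (b :: E.map Prod.snd).filter fun w =>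
    decide (w ∈ R) || E.any fun e => decide (e.1 ∈ R) && decide (e.2 = w) with hf
  have hreach : reachable E b = f^[E.length] [b] := by
    have : ∀ (l : List (V × V)) R, l.foldl (fun R _ => f R) R = f^[l.length] R := by
      intro l
      induction l with
      | nil => intro R; rfl
      | cons e l ih => intro R; exact ih (f R)
    exact this E [b]
  have hmem : ∀ R w, w ∈ f R ↔ w ∈ b :: E.map Prod.snd ∧ (w ∈ R ∨ ∃ y ∈ R, (y, w) ∈ E) := by
    intro R w
    rw [hf, List.mem_filter]
    refine and_congr_right fun _ => ?_
    simp only [Bool.or_eq_true, decide_eq_true_eq, List.any_eq_true, Bool.and_eq_true, Prod.exists]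
    refine or_congr_right ?_
    constructor
    · rintro ⟨y, z, he, hy, rfl⟩
      exact ⟨y, hy, he⟩
    · rintro ⟨y, hy, he⟩
      exact ⟨y, w, he, hy, rfl⟩
  have hsub : ∀ n, ∀ w ∈ f^[n] [b], w ∈ b :: E.map Prod.snd := by
    intro n
    cases n with
    | zero => intro w hw; simp at hw; simp [hw]
    | succ n =>
      intro w hw
      rw [Function.iterate_succ_apply'] at hw
      exact ((hmem _ _).1 hw).1
  have hmono : ∀ n, ∀ w ∈ f^[n] [b], w ∈ f^[n + 1] [b] := by
    intro n w hw
    rw [Function.iterate_succ_apply', hmem]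
    exact ⟨hsub n w hw, Or.inl hw⟩
  rw [hreach]
  constructor
  · have : ∀ n, ∀ w ∈ f^[n] [b], ReflTransGen (fun y z => (y, z) ∈ E) b w := by
      intro n
      induction n with
      | zero =>
        intro w hw
        rw [List.mem_singleton.1 hw]
      | succ n ih =>
        intro w hw
        rw [Function.iterate_succ_apply', hmem] at hw
        rcases hw.2 with h | ⟨y, hy, he⟩
        · exact ih w h
        · exact (ih y hy).tail he
    exact this _ u
  · -- the sets of vertices that are found grow until they are closed under the edges
    have hstab : ∀ n, (∃ m ≤ n, ∀ w ∈ f^[m + 1] [b], w ∈ f^[m] [b]) ∨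
        n + 2 ≤ (f^[n + 1] [b]).toFinset.card := by
      intro n
      by_cases h : ∃ m ≤ n, ∀ w ∈ f^[m + 1] [b], w ∈ f^[m] [b]
      · exact Or.inl h
      · right
        have h' : ∀ m ≤ n, (f^[m] [b]).toFinset.card < (f^[m + 1] [b]).toFinset.card := by
          intro m hm
          refine Finset.card_lt_card ⟨fun w hw => ?_, fun hs => h ⟨m, hm, fun w hw => ?_⟩⟩
          · rw [List.mem_toFinset] at hw ⊢
            exact hmono m w hw
          · simpa using hs (List.mem_toFinset.2 hw)
        have : ∀ m ≤ n + 1, m + 1 ≤ (f^[m] [b]).toFinset.card := by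
          intro m hm
          induction m with
          | zero => simp
          | succ m ih =>
            have h₁ := ih (by omega)
            have h₂ := h' m (by omega)
            omega
        exact this (n + 1) le_rfl
    -- There are at most `E.length + 1` candidates, while growth in each of `E.length + 1` rounds
    -- from a singleton would give `E.length + 2` vertices.
    have hclosed : ∀ w ∈ f^[E.length + 1] [b], w ∈ f^[E.length] [b] := by
      rcases hstab E.length with ⟨m, hm, hfix⟩ | hcard
      · have hall : ∀ n, m ≤ n → ∀ w ∈ f^[n + 1] [b], w ∈ f^[n] [b] := by
          intro n hn
          induction n, hn using Nat.le_induction with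
          | base => exact hfix
          | succ n hn ih =>
            intro w hw
            rw [Function.iterate_succ_apply', hmem] at hw
            rw [Function.iterate_succ_apply', hmem]
            refine ⟨hw.1, ?_⟩
            rcases hw.2 with h | ⟨y, hy, he⟩
            · exact Or.inl (ih w h)
            · exact Or.inr ⟨y, ih y hy, he⟩
        exact hall _ hm
      · have h₁ : (f^[E.length + 1] [b]).toFinset.card ≤ (b :: E.map Prod.snd).toFinset.card :=
          Finset.card_le_card fun w hw => by
            rw [List.mem_toFinset] at hw ⊢
            exact hsub _ w hw
        have h₂ := List.toFinset_card_le (b :: E.map Prod.snd)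
        simp only [List.length_cons, List.length_map] at h₂
        omega
    intro hu
    induction hu with
    | refl =>
      have : ∀ n, b ∈ f^[n] [b] := by
        intro n
        induction n with
        | zero => simp
        | succ n ih => exact hmono n b ih
      exact this _
    | tail _ he ih =>
      refine hclosed _ ?_
      rw [Function.iterate_succ_apply', hmem]
      exact ⟨List.mem_cons_of_mem _ (List.mem_map.2 ⟨_, he, rfl⟩), Or.inr ⟨_, ih, he⟩⟩

end

section

variable {k : ℕ}

/-- The edges given by a list of facts. -/
def edgesOf (l : List (RawFact k)) : List (Vertex k × Vertex k) :=
  l.flatMap fun f =>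
    match f with
    | (.R i, [a, b]) => [((i, a), (cyclicSucc i, b))]
    | _ => []

theorem mem_edgesOf (l : List (RawFact k)) (u w : Vertex k) :
    (u, w) ∈ edgesOf l ↔ Edge {f | f ∈ l} u w := by
  obtain ⟨i, a⟩ := u
  obtain ⟨j, b⟩ := w
  simp only [edgesOf, List.mem_flatMap, Edge]
  constructor
  · rintro ⟨⟨r, args⟩, hf, h⟩
    split at h
    · rename_i i' a' b' heq
      simp only [List.mem_singleton, Prod.mk.injEq] at h
      obtain ⟨⟨rfl, rfl⟩, rfl, rfl⟩ := h
      rw [heq] at hf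
      exact ⟨hf, rfl⟩
    · simp at h
  · rintro ⟨hf, h⟩
    obtain rfl : j = cyclicSucc i := h
    exact ⟨_, hf, by simp⟩

open Classical in
/-- The test for an elementary cycle that is given by a path of `k` edges and that is not one of
the cycles of the list of facts. -/
noncomputable def goodPath (l : List (RawFact k)) (p : Vertex k × List (Vertex k) × Vertex k) :
    Bool :=
  decide (p.1.1.val = 0) &&
    (!(decide (p.2.2 = p.1) && decide ((ACqRel.S, (p.1 :: p.2.1).map Prod.snd) ∈ l)) &&
      decide (p.1 ∈ reachable ((edgesOf l).filter fun e => !decide (e.2 ∈ p.2.1)) p.2.2))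

open Classical in
/-- The decision procedure. -/
noncomputable def decideCertainty (l : List (RawFact k)) : Bool :=
  (edgesOf l).any fun e => (reachable (edgesOf l) e.1).all fun w =>
    ((edgesOf l).any fun e' => decide (e'.1 = w)) &&
      !((paths (edgesOf l) (k - 1)).any fun p => decide (p.1 = w) && goodPath l p)

/-- `MarkedCycle` also requires a start at position `0`; here that follows from the test on `w`, so
only membership of the `S`-fact has to be checked. -/
theorem goodPath_iff (hk : 1 ≤ k) (l : List (RawFact k)) (w : Vertex k) :
    (∃ p ∈ paths (edgesOf l) (k - 1), p.1 = w ∧ goodPath l p = true) ↔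
      w.1.val = 0 ∧ OnGoodCycle (Edge {f | f ∈ l}) (MarkedCycle {f | f ∈ l}) k w := by
  classical
  have hE : (fun y z => (y, z) ∈ edgesOf l) = Edge {f | f ∈ l} := by
    funext y z
    exact propext (mem_edgesOf l y z)
  have hgood : ∀ x mid b, goodPath l (x, mid, b) = true ↔ x.1.val = 0 ∧
      ¬ (b = x ∧ (ACqRel.S, (x :: mid).map Prod.snd) ∈ l) ∧
      ReflTransGen (fun y z => Edge {f | f ∈ l} y z ∧ z ∉ mid) b x := by
    intro x mid b
    have : (fun y z => (y, z) ∈ (edgesOf l).filter fun e => !decide (e.2 ∈ mid)) =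
        fun y z => Edge {f | f ∈ l} y z ∧ z ∉ mid := by
      funext y z
      refine propext ?_
      rw [List.mem_filter, mem_edgesOf]
      simp
    simp only [goodPath, Bool.and_eq_true, decide_eq_true_eq, mem_reachable, this,
      Bool.not_eq_true', Bool.and_eq_false_iff, decide_eq_false_iff_not, not_and_or]
  constructor
  · rintro ⟨⟨x, mid, b⟩, hp, rfl, h⟩
    obtain ⟨h₁, h₂, h₃⟩ := (hgood _ _ _).1 h
    obtain ⟨h₄, h₅⟩ := (mem_paths _ _ _ _ _).1 hp
    rw [hE] at h₅
    exact ⟨h₁, mid, b, by omega, h₅, fun h => h₂ ⟨h.1, h.2.1⟩, h₃⟩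
  · rintro ⟨h₁, mid, b, h₄, h₅, h₂, h₃⟩
    refine ⟨(w, mid, b), (mem_paths _ _ _ _ _).2 ⟨by omega, ?_⟩, rfl,
      (hgood _ _ _).2 ⟨h₁, fun h => h₂ ⟨h.1, h.2, fun x hx => ?_⟩, h₃⟩⟩
    · rw [hE]
      exact h₅
    · simp only [List.head?_cons, Option.mem_def, Option.some.injEq] at hx
      exact hx ▸ h₁

/-- This is the negation of `exists_region_univ_iff`: certainty is witnessed by the source of an
edge that reaches neither a sink nor a good cycle. -/
theorem decideCertainty_iff (hk : 1 ≤ k) (l : List (RawFact k)) : decideCertainty l = true ↔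
    ¬ ∃ g, Region (Edge {f | f ∈ l}) (MarkedCycle {f | f ∈ l}) k Set.univ g := by
  classical
  have hE : (fun y z => (y, z) ∈ edgesOf l) = Edge {f | f ∈ l} := by
    funext y z
    exact propext (mem_edgesOf l y z)
  have hout : ∀ w, (∃ e ∈ edgesOf l, e.1 = w) ↔ ∃ y, Edge {f | f ∈ l} w y := by
    intro w
    constructor
    · rintro ⟨⟨x, y⟩, he, rfl⟩
      exact ⟨y, (mem_edgesOf _ _ _).1 he⟩
    · rintro ⟨y, h⟩
      exact ⟨(w, y), (mem_edgesOf _ _ _).2 h, rfl⟩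
  rw [exists_region_univ_iff (Edge.typing _) hk (MarkedCycle.head_eq _)
    ((edgesOf l).map Prod.fst).toFinset]
  · simp only [decideCertainty, List.any_eq_true, List.all_eq_true, mem_reachable, hE,
      Bool.and_eq_true, Bool.not_eq_true', decide_eq_true_eq, hout, ← goodPath_iff hk]
    simp only [List.mem_toFinset, List.mem_map]
    push Not
    constructor
    · rintro ⟨e, he, h⟩
      refine ⟨e.1, ⟨e, he, rfl⟩, fun w hw => ?_⟩
      obtain ⟨h₁, h₂⟩ := h w hw
      refine ⟨h₁, fun p hp hpw hg => ?_⟩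
      rw [List.any_eq_false] at h₂
      exact h₂ p hp (by simp [hpw, hg])
    · rintro ⟨_, ⟨e, he, rfl⟩, h⟩
      refine ⟨e, he, fun w hw => ?_⟩
      obtain ⟨h₁, h₂⟩ := h w hw
      refine ⟨h₁, ?_⟩
      rw [List.any_eq_false]
      intro p hp hg
      simp only [Bool.and_eq_true, decide_eq_true_eq] at hg
      exact h₂ p hp hg.1 hg.2
  · intro x y h
    rw [List.mem_toFinset, List.mem_map]
    exact ⟨(x, y), (mem_edgesOf _ _ _).2 h, rfl⟩

end

end CQA

/-! ### Polynomial running time of the decision procedure and of the parser. -/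

namespace CQA

open TreeMachine

/-! ### The decision procedure runs in polynomial time -/

theorem _root_.TreeMachine.PT.of_finite {ι α β : Type} [Finite ι] [Enc ι] [Enc α] [Enc β]
    (f : ι → β) {i : α → ι} (hi : PT i) : PT (fun a => f (i a)) :=
  PT.finite_comp (f := fun i _ => f i) hi fun _ => PT.const _

section

variable {α V : Type} [Enc α] [Enc V] [DecidableEq V]

/-- Every round filters the same candidate list, so the intermediate results are sublists of it and
cannot grow. -/
theorem PT_reachable {E : α → List (V × V)} {b : α → V} (hE : PT E) (hb : PT b) :
    PT (fun a => reachable (E a) (b a)) := by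
  have hV : PT (fun a => b a :: (E a).map Prod.snd) :=
    PT.cons hb (PT.map (f := fun _ e => e.2) hE (PT.snd (PT.snd PT.id)))
  obtain ⟨B, hB⟩ := hV.size_le
  refine PT.foldl (f := fun a R _ => (b a :: (E a).map Prod.snd).filter fun w =>
    decide (w ∈ R) || (E a).any fun e => decide (e.1 ∈ R) && decide (e.2 = w)) hE
    (PT.cons hb PT.nil) ?_ B fun a n => ?_
  · refine PT.filter (p := fun (x : α × List V × V × V) w => decide (w ∈ x.2.1) ||
      (E x.1).any fun e => decide (e.1 ∈ x.2.1) && decide (e.2 = w)) (hV.comp (PT.fst PT.id)) ?_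
    have hR : PT (fun x : (α × List V × V × V) × V => x.1.2.1) :=
      PT.fst (PT.snd (PT.fst PT.id))
    refine PT.or (PT.mem (PT.snd PT.id) hR) ?_
    refine PT.any (p := fun (x : (α × List V × V × V) × V) e =>
      decide (e.1 ∈ x.1.2.1) && decide (e.2 = x.2)) (hE.comp (PT.fst (PT.fst PT.id))) ?_
    exact PT.and (PT.mem (PT.fst (PT.snd PT.id)) (hR.comp (PT.fst PT.id)))
      (PT.eq (PT.snd (PT.snd PT.id)) (PT.snd (PT.fst PT.id)))
  · refine (size_sublist_le ?_).trans (hB a)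
    have key : ∀ (m : List (V × V)) (R : List V), R.Sublist (b a :: (E a).map Prod.snd) →
        (m.foldl (fun R _ => (b a :: (E a).map Prod.snd).filter fun w =>
          decide (w ∈ R) || (E a).any fun e => decide (e.1 ∈ R) && decide (e.2 = w)) R).Sublist
            (b a :: (E a).map Prod.snd) := by
      intro m
      induction m with
      | nil => exact fun R hR => hR
      | cons e m ih => exact fun R _ => ih _ List.filter_sublist
    exact key _ _ (by simp)

/-- The number `n` is fixed and not part of the input: each level composes one more polynomial-time
function. -/
theorem PT_paths {E : α → List (V × V)} (hE : PT E) (n : ℕ) : PT (fun a => paths (E a) n) := by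
  induction n with
  | zero =>
    exact PT.map (f := fun (_ : α) (e : V × V) => (e.1, ([] : List V), e.2)) hE
      (PT.pair (PT.fst (PT.snd PT.id)) (PT.pair PT.nil (PT.snd (PT.snd PT.id))))
  | succ n ih =>
    refine PT.flatMap (f := fun a p =>
      ((E a).filter fun e => decide (e.2 = p.1)).map fun e => (e.1, p.1 :: p.2.1, p.2.2)) ih ?_
    refine PT.map (f := fun (x : α × V × List V × V) (e : V × V) => (e.1, x.2.1 :: x.2.2.1, x.2.2.2)) ?_ ?_
    · exact PT.filter (p := fun (x : α × V × List V × V) e => decide (e.2 = x.2.1))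
        (hE.comp (PT.fst PT.id)) (PT.eq (PT.snd (PT.snd PT.id)) (PT.fst (PT.snd (PT.fst PT.id))))
    · have hp : PT (fun x : (α × V × List V × V) × V × V => x.1.2) := PT.snd (PT.fst PT.id)
      exact PT.pair (PT.fst (PT.snd PT.id))
        (PT.pair (PT.cons (PT.fst hp) (PT.fst (PT.snd hp))) (PT.snd (PT.snd hp)))

end

section

variable {k : ℕ}

instance : Finite (ACqRel k) := ACqRel.finite k

noncomputable instance : Enc (ACqRel k) := Enc.ofFinite _

noncomputable instance : Enc (Fin k) := Enc.ofFinite _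

theorem PT_edgesOf : PT (edgesOf : List (RawFact k) → List (Vertex k × Vertex k)) := by
  let f : ACqRel k → List Const → List (Vertex k × Vertex k) := fun r args =>
    match (r, args) with
    | (.R i, [a, b]) => [((i, a), (cyclicSucc i, b))]
    | _ => []
  have hf : ∀ r, PT (f r) := by
    rintro (i | _)
    · refine PT.list_cases (l := fun args : List Const => args) (f := fun _ => [])
        (g := fun x => match x.2.2 with
          | [b] => [((i, x.2.1), (cyclicSucc i, b))]
          | _ => []) PT.id PT.nil ?_ ?_ ?_
      · refine PT.list_cases (l := fun x : List Const × Const × List Const => x.2.2)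
          (f := fun _ => [])
          (g := fun x => bif x.2.2.isEmpty then [((i, x.1.2.1), (cyclicSucc i, x.2.1))] else [])
          (PT.snd (PT.snd PT.id)) PT.nil ?_ ?_ ?_
        · refine PT.cond (PT.isEmpty (PT.snd (PT.snd PT.id))) (PT.cons (PT.pair
            (PT.pair (PT.const i) (PT.fst (PT.snd (PT.fst PT.id))))
            (PT.pair (PT.const _) (PT.fst (PT.snd PT.id)))) PT.nil) PT.nil
        · intro x hx
          rw [hx]
        · intro x b t hx
          rw [hx]
          cases t <;> rfl
      · rintro _ rfl
        rfl
      · rintro _ a t rfl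
        rcases t with _ | ⟨b, _ | ⟨c, t⟩⟩ <;> rfl
    · exact (PT.nil).congr fun a => by rfl
  exact PT.flatMap (f := fun (_ : List (RawFact k)) (x : RawFact k) => f x.1 x.2) PT.id ((PT.finite hf).comp (PT.snd PT.id))

theorem PT_goodPath : PT (fun x : List (RawFact k) × Vertex k × List (Vertex k) × Vertex k =>
    goodPath x.1 x.2) := by
  classical
  have hl : PT (fun x : List (RawFact k) × Vertex k × List (Vertex k) × Vertex k => x.1) :=
    PT.fst PT.id
  have hx : PT (fun x : List (RawFact k) × Vertex k × List (Vertex k) × Vertex k => x.2.1) :=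
    PT.fst (PT.snd PT.id)
  have hm : PT (fun x : List (RawFact k) × Vertex k × List (Vertex k) × Vertex k => x.2.2.1) :=
    PT.fst (PT.snd (PT.snd PT.id))
  have hb : PT (fun x : List (RawFact k) × Vertex k × List (Vertex k) × Vertex k => x.2.2.2) :=
    PT.snd (PT.snd (PT.snd PT.id))
  refine PT.and (PT.of_finite (fun i : Fin k => decide (i.val = 0)) (PT.fst hx)) (PT.and
    (PT.not (PT.and (PT.eq hb hx) (PT.mem (PT.pair (PT.const ACqRel.S) ?_) hl)))
    (PT.mem hx (PT_reachable ?_ hb)))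
  · exact PT.map (f := fun _ v => v.2) (PT.cons hx hm) (PT.snd (PT.snd PT.id))
  · exact PT.filter (p := fun (x : List (RawFact k) × Vertex k × List (Vertex k) × Vertex k) e =>
      !decide (e.2 ∈ x.2.2.1)) (PT_edgesOf.comp hl)
      (PT.not (PT.mem (PT.snd (PT.snd PT.id)) (hm.comp (PT.fst PT.id))))

theorem PT_decideCertainty : PT (decideCertainty : List (RawFact k) → Bool) := by
  classical
  refine PT.any (p := fun l e => (reachable (edgesOf l) e.1).all fun w =>
    ((edgesOf l).any fun e' => decide (e'.1 = w)) &&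
      !((paths (edgesOf l) (k - 1)).any fun p => decide (p.1 = w) && goodPath l p)) PT_edgesOf ?_
  refine PT.all (p := fun (x : List (RawFact k) × Vertex k × Vertex k) w =>
    ((edgesOf x.1).any fun e' => decide (e'.1 = w)) &&
      !((paths (edgesOf x.1) (k - 1)).any fun p => decide (p.1 = w) && goodPath x.1 p))
    (PT_reachable (PT_edgesOf.comp (PT.fst PT.id)) (PT.fst (PT.snd PT.id))) ?_
  have hE : PT (fun x : (List (RawFact k) × Vertex k × Vertex k) × Vertex k => edgesOf x.1.1) :=
    PT_edgesOf.comp (PT.fst (PT.fst PT.id))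
  refine PT.and (PT.any (p := fun (x : (List (RawFact k) × Vertex k × Vertex k) × Vertex k) e' =>
    decide (e'.1 = x.2)) hE (PT.eq (PT.fst (PT.snd PT.id)) (PT.snd (PT.fst PT.id)))) (PT.not ?_)
  exact PT.any (p := fun (x : (List (RawFact k) × Vertex k × Vertex k) × Vertex k) p =>
    decide (p.1 = x.2) && goodPath x.1.1 p) (PT_paths hE _)
    (PT.and (PT.eq (PT.fst (PT.snd PT.id)) (PT.snd (PT.fst PT.id)))
      (PT_goodPath.comp (PT.pair (PT.fst (PT.fst (PT.fst PT.id))) (PT.snd PT.id))))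

end

/-! ### Parsing -/

section

variable {k : ℕ} {hk : 2 ≤ k}

/-- The state of the parser, which reads the input word from right to left: whether the word is
well-formed so far, the arguments that are not yet part of a fact, and the facts. -/
abbrev ParseState (k : ℕ) : Type := Bool × List Const × List (RawFact k)

/-- Reads a symbol. -/
def parseStep (s : ParseState k) : Symbol (acqSchema k hk) → ParseState k
  | .rel r => (s.1 && decide (s.2.1.length = (acqSchema k hk).arity r), [], (r, s.2.1) :: s.2.2)
  | .bit b =>
    match s.2.1 with
    | [] => (false, [], s.2.2)
    | a :: t => (s.1, (b :: a) :: t, s.2.2)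
  | .sep => (s.1, [] :: s.2.1, s.2.2)

/-- Reads a word. -/
def parse (w : List (Symbol (acqSchema k hk))) : ParseState k :=
  w.foldr (fun x s => parseStep s x) (true, [], [])

theorem foldr_encodeConst (c : Const) (s : ParseState k) :
    (encodeConst c).foldr (fun (x : Symbol (acqSchema k hk)) s => parseStep s x) s =
      (s.1, c :: s.2.1, s.2.2) := by
  induction c with
  | nil => rfl
  | cons b c ih =>
    have : encodeConst (b :: c) = (.bit b : Symbol (acqSchema k hk)) :: encodeConst c := rfl
    rw [this, List.foldr_cons, ih]
    rfl

theorem foldr_encodeArgs (args : List Const) (s : ParseState k) :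
    (args.flatMap encodeConst).foldr (fun (x : Symbol (acqSchema k hk)) s => parseStep s x) s =
      (s.1, args ++ s.2.1, s.2.2) := by
  induction args with
  | nil => rfl
  | cons c args ih => rw [List.flatMap_cons, List.foldr_append, ih, foldr_encodeConst]; rfl

/-- The relation name and the arguments of a fact. -/
def toRaw (A : Fact (acqSchema k hk)) : RawFact k := (A.rel, A.args)

/-- Reading from the right, all arguments of a fact are pending when its relation name is met, and
their number can be compared with the arity. -/
theorem parse_encodeFacts (l : List (Fact (acqSchema k hk))) :
    parse (encodeFacts l) = (true, [], l.map toRaw) := by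
  induction l with
  | nil => rfl
  | cons A l ih =>
    have h : encodeFacts (A :: l) =
        .rel A.rel :: (A.args.flatMap encodeConst ++ encodeFacts l) := by
      simp [encodeFacts, encodeFact]
    have h' : (encodeFacts l).foldr (fun x s => parseStep s x) (true, [], []) =
      (true, [], l.map toRaw) := ih
    rw [parse, h, List.foldr_cons, List.foldr_append, h', foldr_encodeArgs]
    simp only [parseStep, List.append_nil, List.map_cons]
    rw [decide_eq_true A.length_args]
    rfl

/-- Converse of `parse_encodeFacts`. The invariant allows for pending arguments in front of the
complete facts; `decideWord` then asks that none are left. -/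
theorem eq_of_parse (w : List (Symbol (acqSchema k hk))) (h : (parse w).1 = true) :
    ∃ l : List (Fact (acqSchema k hk)), w = (parse w).2.1.flatMap encodeConst ++ encodeFacts l ∧
      (parse w).2.2 = l.map toRaw := by
  induction w with
  | nil => exact ⟨[], rfl, rfl⟩
  | cons x w ih =>
    have hp : parse (x :: w) = parseStep (parse w) x := rfl
    rw [hp] at h ⊢
    rcases x with r | b | _
    · simp only [parseStep, Bool.and_eq_true, decide_eq_true_eq] at h ⊢
      obtain ⟨l, h₁, h₂⟩ := ih h.1
      refine ⟨⟨r, (parse w).2.1, h.2⟩ :: l, ?_, ?_⟩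
      · conv_lhs => rw [h₁]
        simp [encodeFacts, encodeFact]
      · rw [h₂]
        rfl
    · rcases ha : (parse w).2.1 with _ | ⟨a, t⟩
      · simp [parseStep, ha] at h
      · simp only [parseStep, ha] at h ⊢
        obtain ⟨l, h₁, h₂⟩ := ih h
        refine ⟨l, ?_, h₂⟩
        conv_lhs => rw [h₁, ha]
        simp [encodeConst]
    · obtain ⟨l, h₁, h₂⟩ := ih h
      refine ⟨l, ?_, h₂⟩
      conv_lhs => rw [h₁]
      simp [parseStep, encodeConst]

theorem symbol_finite : Finite (Symbol (acqSchema k hk)) :=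
  Finite.of_surjective (fun o : (ACqRel k ⊕ Bool) ⊕ Unit =>
    (o.elim (fun o => o.elim Symbol.rel Symbol.bit) fun _ => .sep : Symbol (acqSchema k hk)))
    fun s =>
      match s with
      | .rel r => ⟨.inl (.inl r), rfl⟩
      | .bit b => ⟨.inl (.inr b), rfl⟩
      | .sep => ⟨.inr (), rfl⟩

instance : Finite (Symbol (acqSchema k hk)) := symbol_finite

noncomputable instance : Enc (Symbol (acqSchema k hk)) := Enc.ofFinite _

theorem _root_.TreeMachine.PT.length_eq {α β : Type} [Enc α] [Enc β] (n : ℕ) {l : α → List β}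
    (hl : PT l) : PT (fun a => decide ((l a).length = n)) := by
  suffices h : PT (fun m : List β => decide (m.length = n)) from h.comp hl
  clear hl l
  induction n with
  | zero => exact (PT.isEmpty PT.id).congr fun m => by cases m <;> rfl
  | succ n ih =>
    refine PT.list_cases (f := fun _ => false) (g := fun x => decide (x.2.2.length = n))
      PT.id (PT.const _) (ih.comp (PT.snd (PT.snd PT.id))) ?_ ?_
    · rintro _ rfl
      rfl
    · rintro _ b t rfl
      simp

theorem PT_parseStep : PT (fun x : Symbol (acqSchema k hk) × ParseState k => parseStep x.2 x.1) := by
  refine PT.finite (f := fun x (s : ParseState k) => parseStep s x) fun x => ?_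
  have hargs : PT (fun s : ParseState k => s.2.1) := PT.fst (PT.snd PT.id)
  have hfacts : PT (fun s : ParseState k => s.2.2) := PT.snd (PT.snd PT.id)
  rcases x with r | b | _
  · exact PT.pair (PT.and (PT.fst PT.id) (PT.length_eq _ hargs))
      (PT.pair PT.nil (PT.cons (PT.pair (PT.const (β := ACqRel k) r) hargs) hfacts))
  · refine PT.list_cases (f := fun s : ParseState k => (false, [], s.2.2))
      (g := fun x => (x.1.1, (b :: x.2.1) :: x.2.2, x.1.2.2)) hargs
      (PT.pair (PT.const _) (PT.pair PT.nil hfacts)) ?_ ?_ ?_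
    · exact PT.pair (PT.fst (PT.fst PT.id)) (PT.pair (PT.cons (PT.cons (PT.const b)
        (PT.fst (PT.snd PT.id))) (PT.snd (PT.snd PT.id))) (hfacts.comp (PT.fst PT.id)))
    · intro s hs
      simp only [parseStep, hs]
    · intro s a t hs
      simp only [parseStep, hs]
  · exact PT.pair (PT.fst PT.id) (PT.pair (PT.cons PT.nil hargs) hfacts)

/-- A relation name moves the pending arguments into a fact without copying them, so each symbol
enlarges the state by at most a constant. -/
theorem PT_parse : PT (parse : List (Symbol (acqSchema k hk)) → ParseState k) := by
  have := Fintype.ofFinite (ACqRel k)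
  have hr : ∀ r : ACqRel k, size r ≤ ∑ r : ACqRel k, size r := fun r =>
    Finset.single_le_sum (f := fun r : ACqRel k => size r) (fun _ _ => Nat.zero_le _)
      (Finset.mem_univ r)
  refine (PT.foldl_of_growth (l := fun w : List (Symbol (acqSchema k hk)) => w.reverse)
    (s := fun _ => ((true, [], []) : ParseState k)) (f := fun _ s x => parseStep s x)
    (PT.reverse PT.id) (PT.const _)
    (PT_parseStep.comp (PT.pair (PT.snd (PT.snd PT.id)) (PT.fst (PT.snd PT.id))))
    (Polynomial.C (∑ r : ACqRel k, size r + 10)) ?_).congr fun w => ?_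
  · rintro _ ⟨ok, args, facts⟩ x
    rw [Polynomial.eval_C]
    have h₁ := one_le_size ok
    rcases x with r | b | _
    · have h₂ := size_bool_le (ok && decide (args.length = (acqSchema k hk).arity r))
      have h₃ := hr (r : ACqRel k)
      have h₄ : size (parseStep (ok, args, facts) (Symbol.rel r : Symbol (acqSchema k hk))) =
        size (ok && decide (args.length = (acqSchema k hk).arity r)) +
          (1 + ((@size (ACqRel k) _ r + size args + 1) + size facts + 1) + 1) + 1 := rfl
      have h₅ : size ((ok, args, facts) : ParseState k) =
        size ok + (size args + size facts + 1) + 1 := rfl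
      omega
    · have h₂ := size_bool_le b
      have h₅ : size ((ok, args, facts) : ParseState k) =
        size ok + (size args + size facts + 1) + 1 := rfl
      rcases args with _ | ⟨a, t⟩
      · have h₄ : size (parseStep (ok, [], facts) (Symbol.bit b : Symbol (acqSchema k hk))) =
          1 + (1 + size facts + 1) + 1 := rfl
        omega
      · have h₄ : size (parseStep (ok, a :: t, facts) (Symbol.bit b : Symbol (acqSchema k hk))) =
          size ok + ((size b + size a + 1) + size t + 1 + size facts + 1) + 1 := rfl
        rw [size_cons] at h₅
        omega
    · have h₄ : size (parseStep (ok, args, facts) (Symbol.sep : Symbol (acqSchema k hk))) =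
        size ok + ((1 + size args + 1) + size facts + 1) + 1 := rfl
      have h₅ : size ((ok, args, facts) : ParseState k) =
        size ok + (size args + size facts + 1) + 1 := rfl
      omega
  · rw [List.foldl_reverse]
    rfl

/-- The characteristic function of the language of `CERTAINTY(ACq_k)`. -/
noncomputable def decideWord (w : List (Symbol (acqSchema k hk))) : Bool :=
  (parse w).1 && ((parse w).2.1.isEmpty && decideCertainty (parse w).2.2)

/-- The procedure's answer depends only on the set of listed facts, so order and repetitions are
harmless. -/
theorem mem_certainty_iff (db : Database (acqSchema k hk)) (l : List (Fact (acqSchema k hk)))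
    (h : ∀ A, A ∈ l ↔ A ∈ db) :
    db ∈ certainty (acq k hk) ↔ decideCertainty (l.map toRaw) = true := by
  have hF : {f | f ∈ l.map toRaw} = rawFacts db := by
    ext p
    show p ∈ l.map toRaw ↔ ∃ A ∈ db, toRaw A = p
    simp [h]
  rw [decideCertainty_iff (by omega), hF, ← not_mem_certainty_iff, not_not]

theorem decideWord_iff (w : List (Symbol (acqSchema k hk))) :
    decideWord w = true ↔ w ∈ languageOf (certainty (acq k hk)) := by
  classical
  constructor
  · intro h
    simp only [decideWord, Bool.and_eq_true, List.isEmpty_iff] at h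
    obtain ⟨l, h₁, h₂⟩ := eq_of_parse w h.1
    rw [h₂] at h
    rw [h.2.1] at h₁
    exact ⟨l.toFinset, (mem_certainty_iff _ l fun A => by simp).2 h.2.2, l, fun A => by simp, h₁⟩
  · rintro ⟨db, hdb, l, hl, rfl⟩
    simp [decideWord, parse_encodeFacts, (mem_certainty_iff db l hl).1 hdb]

end

end CQA

theorem theorem3 (k : ℕ) (hk : 2 ≤ k) :
    CQA.InP (CQA.languageOf (CQA.certainty (CQA.acq k hk))) := by
  exact TreeMachine.inP_of_PT (f := CQA.decideWord)
    (.and (.fst CQA.PT_parse) (.and (.isEmpty (.fst (.snd CQA.PT_parse)))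
      (CQA.PT_decideCertainty.comp (.snd (.snd CQA.PT_parse))))) CQA.decideWord_iff
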